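/- **Theorem.** Let $\Bbbk$ be a field with $\operatorname{char}\Bbbk\neq 2$. *Operads.* An operad means a symmetric $\Bbbk$-linear operad $\mathcal P$ in partial-composition form (right $\Bbbk\mathbb S_n$-modules $\mathcal P(n)$, an identity $1\in\mathcal P(1)$ and partial compositions $\circ_i:\mathcal P(m)\otimes\mathcal P(n)\to\mathcal P(m+n-1)$, $1\le i\le m$, satisfying the unit, sequential, parallel and equivariance axioms) that is reduced ($\mathcal P(0)=0$) and locally finite ($\dim\mathcal P(n)<\infty$ for all $n$). Morphisms are families of linear maps compatible with the actions, the identities and all $\circ_i$. $\mathcal P$ is $\mathbb A$-trivial if $x*\sigma=x$ for all $n$, all $x\in\mathcal P(n)$ and all even $\sigma\in\mathbb S_n$. $\mathcal P$ is finitely generated if some finite set of operations lies in no proper suboperad. *PGPerm algebras.* A pseudo-graded-Perm (PGPerm) algebra is a unital associative $\mathbb N$-graded algebra $A=\bigoplus_{i\ge0}A_i$ with all $A_i$ finite dimensional, together with decompositions $A_i=A_{i,e}\oplus A_{i,o}$ for $i\ge1$. Homogeneous elements are the elements of $A_0$, $A_{i,e}$, $A_{i,o}$; put $t=0$ on $A_0$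 and $A_{i,e}$, and $t=1$ on $A_{i,o}$. Let $*\,\Xi$ be the endomorphism of $A_1$ that is $\mathrm{id}$ on $A_{1,e}$ and $-\mathrm{id}$ on $A_{1,o}$. It is required that: 1. $\bigoplus_{i\ge1}A_{i,e}$ and $\bigoplus_{i\ge1}A_{i,o}$ are left ideals, and $\bigoplus_{i\ge2}A_{i,e}$ and $\bigoplus_{i\ge2}A_{i,o}$ are two-sided ideals of $A$; 2. $x(yz)=a\,x(zy)$ for homogeneous $x,y,z$ with $\deg x\ge2$, where $a=-1$ if $y\in A_{i,o}$ and $z\in A_{j,o}$ with $i,j$ odd, and $a=1$ otherwise; 3. for $x\in A_1$: $(((xy)*\Xi)z)*\Xi=(((x*\Xi)z)*\Xi)y$ if $y,z\in A_0$; $((xy)*\Xi)z=((x*\Xi)z)y$ if $y\in A_0$ and $z$ is homogeneous of positive degree; $(-1)^{\deg z(\deg y-1)t(y)}(xy)z=(-1)^{(\deg z-1)t(z)}((x*\Xi)z)y$ if $y,z$ are homogeneous of positive degree. Morphisms are homomorphisms of graded algebras that preserve all $A_{i,e}$ and $A_{i,o}$. *The functor $G_{\mathbb A\text{-triv}}$.*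 For a PGPerm algebra $A$ put $\mathcal P_A(0)=0$ and $\mathcal P_A(n)=A_{n-1}$ for $n\ge1$, with identity $1_A$. The group $\mathbb S_n$ acts trivially on $\mathcal P_A(1)=A_0$ and on $A_{n-1,e}$, and by the sign on $A_{n-1,o}$. For homogeneous $x\in\mathcal P_A(m)$, $y\in\mathcal P_A(n)$ put $$x\circ_iy=\begin{cases}(-1)^{(n-1)(i-1)t(x)}\,xy & m\ge3,\\ xy & m\le2,\ i=1,\\ ((x*\Xi)y)*\Xi & m=i=2,\ n=1,\\ (-1)^{n\,t(y)}(x*\Xi)y & m=i=2,\ n\ge2.\end{cases}$$ On morphisms, $G_{\mathbb A\text{-triv}}$ restricts a homomorphism to the graded pieces. *The functor $\mathcal F_{\mathbb A\text{-triv}}$.* For an $\mathbb A$-trivial operad $\mathcal P$ put $A_i=\mathcal P(i+1)$ and $A_{\mathcal P}=\bigoplus_{i\ge0}A_i$, with product $x\cdot y=x\circ_1y$. For $i\ge1$ let $A_{i,e}$ (resp. $A_{i,o}$) be the subspace of $\mathcal P(i+1)$ on which $\mathbb S_{i+1}$ acts trivially (resp. by the sign). On morphisms, $\mathcal F_{\mathbb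 A\text{-triv}}$ takes the direct sum of the components. Then $G_{\mathbb A\text{-triv}}(A)$ is an $\mathbb A$-trivial operad for every PGPerm algebra $A$, and $\mathcal F_{\mathbb A\text{-triv}}(\mathcal P)$ is a PGPerm algebra for every $\mathbb A$-trivial operad $\mathcal P$. The resulting functors $G_{\mathbb A\text{-triv}}$ and $\mathcal F_{\mathbb A\text{-triv}}$ are mutually inverse equivalences between the category of PGPerm algebras and the category of $\mathbb A$-trivial operads. Moreover, a PGPerm algebra $A$ is finitely generated as a $\Bbbk$-algebra if and only if the operad $G_{\mathbb A\text{-triv}}(A)$ is finitely generated. -/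

import Mathlib

open CategoryTheory DirectSum

universe v u

/-! ### Block permutations -/

/-- Input `i` (counted from `0`) of an `m`-ary operation is replaced by a block of `n` inputs; the
result has `r` inputs, `m + n = r + 1`. `blockPos h i` sends the `a`-th input of the block, and the
input `c ≠ i` of the outer operation, to its position among the `r` inputs. -/
def blockPos {m n r : ℕ} (h : m + n = r + 1) (i : Fin m) : Fin n ⊕ {c : Fin m // c ≠ i} → Fin r
  | .inl a => ⟨i + a, by omega⟩
  | .inr c => if hc : (c.1 : ℕ) < i then ⟨c.1, by omega⟩ else
      ⟨c.1 + n - 1, by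
        have h1 : (c.1 : ℕ) ≠ i := fun e => c.2 (Fin.ext e)
        omega⟩

theorem blockPos_bijective {m n r : ℕ} (h : m + n = r + 1) (i : Fin m) :
    Function.Bijective (blockPos h i) := by
  constructor
  · rintro (a | ⟨c, hc⟩) (b | ⟨d, hd⟩) hab
    · simp only [blockPos, Fin.mk.injEq] at hab
      congr 1
      ext
      omega
    · exfalso
      have h1 : (d : ℕ) ≠ i := fun e => hd (Fin.ext e)
      simp only [blockPos] at hab
      split_ifs at hab <;> simp only [Fin.mk.injEq] at hab <;> omega
    · exfalso
      have h1 : (c : ℕ) ≠ i := fun e => hc (Fin.ext e)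
      simp only [blockPos] at hab
      split_ifs at hab <;> simp only [Fin.mk.injEq] at hab <;> omega
    · have h1 : (c : ℕ) ≠ i := fun e => hc (Fin.ext e)
      have h2 : (d : ℕ) ≠ i := fun e => hd (Fin.ext e)
      simp only [blockPos] at hab
      congr 2
      ext
      split_ifs at hab <;> simp only [Fin.mk.injEq] at hab <;> omega
  · intro j
    by_cases h1 : (j : ℕ) < i
    · refine ⟨.inr ⟨⟨j, by omega⟩, fun e => ?_⟩, ?_⟩
      · have := congrArg Fin.val e
        simp only at this
        omega
      · simp [blockPos, h1]
    · by_cases h2 : (j : ℕ) < i + n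
      · refine ⟨.inl ⟨j - i, by omega⟩, ?_⟩
        ext
        simp only [blockPos]
        omega
      · refine ⟨.inr ⟨⟨j + 1 - n, by omega⟩, fun e => ?_⟩, ?_⟩
        · have := congrArg Fin.val e
          simp only at this
          omega
        · have h3 : ¬ ((j : ℕ) + 1 - n < i) := by omega
          ext
          simp only [blockPos, h3, dite_false]
          omega

/-- `blockPos` as a bijection. -/
noncomputable def blockEquiv {m n r : ℕ} (h : m + n = r + 1) (i : Fin m) :
    Fin n ⊕ {c : Fin m // c ≠ i} ≃ Fin r :=
  Equiv.ofBijective (blockPos h i) (blockPos_bijective h i)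

/-- The permutation `σ'`: `σ` acts inside the block at `i`, everything else is fixed. -/
noncomputable def innerPerm {m n r : ℕ} (h : m + n = r + 1) (i : Fin m)
    (σ : Equiv.Perm (Fin n)) : Equiv.Perm (Fin r) :=
  (blockEquiv h i).symm.trans
    ((Equiv.sumCongr σ (Equiv.refl {c : Fin m // c ≠ i})).trans (blockEquiv h i))

/-- The permutation `φ''`: the block at `i` is moved, in order, to the block at `φ i`, and the other
inputs `c` are moved to `φ c`. -/
noncomputable def outerPerm {m n r : ℕ} (h : m + n = r + 1) (i : Fin m)
    (φ : Equiv.Perm (Fin m)) : Equiv.Perm (Fin r) :=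
  (blockEquiv h i).symm.trans
    ((Equiv.sumCongr (Equiv.refl (Fin n))
      (φ.subtypeEquiv (p := fun c => c ≠ i) (q := fun c => c ≠ φ i)
        (fun _ => φ.injective.ne_iff.symm))).trans (blockEquiv h (φ i)))

/-! ### Symmetric operads -/

/-- The data of a symmetric operad over `k` in partial composition form, before any axiom:
spaces of `n`-ary operations, maps `x ↦ x * σ`, an element `1` of arity one, and partial
compositions `x ∘_i y`. Inputs are counted from `0`, so `comp h i x y` is `x ∘_{i+1} y`; the
arity `r = m + n - 1` of the result is a variable, which avoids transporting along equalities. -/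
structure PreOperad (k : Type u) [Field k] where
  obj : ℕ → Type v
  [addCommGroup : ∀ n, AddCommGroup (obj n)]
  [module : ∀ n, Module k (obj n)]
  act : ∀ {n : ℕ}, Equiv.Perm (Fin n) → obj n →ₗ[k] obj n
  one : obj 1
  comp : ∀ {m n r : ℕ}, m + n = r + 1 → Fin m → obj m →ₗ[k] obj n →ₗ[k] obj r

attribute [instance] PreOperad.addCommGroup PreOperad.module

namespace PreOperad

variable {k : Type u} [Field k]

/-- Morphisms: families of linear maps compatible with the actions, the identities and all
partial compositions. -/
@[ext]
structure Hom (P Q : PreOperad.{v, u} k) where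
  app : ∀ n, P.obj n →ₗ[k] Q.obj n
  map_act : ∀ {n : ℕ} (σ : Equiv.Perm (Fin n)) (x : P.obj n),
    app n (P.act σ x) = Q.act σ (app n x)
  map_one : app 1 P.one = Q.one
  map_comp : ∀ {m n r : ℕ} (h : m + n = r + 1) (i : Fin m) (x : P.obj m) (y : P.obj n),
    app r (P.comp h i x y) = Q.comp h i (app m x) (app n y)

instance : Category (PreOperad.{v, u} k) where
  Hom := Hom
  id P := ⟨fun _ => LinearMap.id, fun _ _ => rfl, rfl, fun _ _ _ _ => rfl⟩
  comp f g := ⟨fun n => g.app n ∘ₗ f.app n,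
    fun σ x => by simp [f.map_act, g.map_act],
    by simp [f.map_one, g.map_one],
    fun h i x y => by simp [f.map_comp, g.map_comp]⟩

/-- The axioms of a symmetric operad. -/
structure IsOperad (P : PreOperad.{v, u} k) : Prop where
  /-- `act` is a right action of the symmetric group. -/
  act_one : ∀ {n : ℕ} (x : P.obj n), P.act 1 x = x
  act_mul : ∀ {n : ℕ} (σ τ : Equiv.Perm (Fin n)) (x : P.obj n),
    P.act (σ * τ) x = P.act τ (P.act σ x)
  comp_one : ∀ {n : ℕ} (i : Fin n) (x : P.obj n), P.comp rfl i x P.one = x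
  one_comp : ∀ {n : ℕ} (x : P.obj n), P.comp (Nat.add_comm 1 n) 0 P.one x = x
  /-- Sequential composition: `(x ∘_i y) ∘_{i-1+j} z = x ∘_i (y ∘_j z)`. -/
  comp_seq : ∀ {l m n r q s : ℕ} (h₁ : l + m = r + 1) (h₂ : r + n = s + 1) (h₃ : m + n = q + 1)
    (h₄ : l + q = s + 1) (i : Fin l) (j : Fin m) (p : Fin r), (p : ℕ) = i + j →
    ∀ (x : P.obj l) (y : P.obj m) (z : P.obj n),
      P.comp h₂ p (P.comp h₁ i x y) z = P.comp h₄ i x (P.comp h₃ j y z)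
  /-- Parallel composition: `(x ∘_i y) ∘_{j-1+m} z = (x ∘_j z) ∘_i y` for `i < j`. -/
  comp_par : ∀ {l m n r q s : ℕ} (h₁ : l + m = r + 1) (h₂ : r + n = s + 1) (h₃ : l + n = q + 1)
    (h₄ : q + m = s + 1) (i j : Fin l) (p : Fin r) (p' : Fin q), i < j →
    (p : ℕ) + 1 = j + m → (p' : ℕ) = i →
    ∀ (x : P.obj l) (y : P.obj m) (z : P.obj n),
      P.comp h₂ p (P.comp h₁ i x y) z = P.comp h₄ p' (P.comp h₃ j x z) y
  comp_act : ∀ {m n r : ℕ} (h : m + n = r + 1) (i : Fin m) (σ : Equiv.Perm (Fin n))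
    (x : P.obj m) (y : P.obj n),
      P.comp h i x (P.act σ y) = P.act (innerPerm h i σ) (P.comp h i x y)
  act_comp : ∀ {m n r : ℕ} (h : m + n = r + 1) (i : Fin m) (φ : Equiv.Perm (Fin m))
    (x : P.obj m) (y : P.obj n),
      P.comp h i (P.act φ x) y = P.act (outerPerm h i φ) (P.comp h (φ i) x y)

/-- `P` is a symmetric operad that is reduced (`P(0) = 0`), locally finite, and `𝔸`-trivial: all
even permutations act trivially. -/
structure IsATrivOperad (P : PreOperad.{v, u} k) : Prop extends IsOperad P where
  reduced : ∀ x : P.obj 0, x = 0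
  locallyFinite : ∀ n, Module.Finite k (P.obj n)
  aTriv : ∀ {n : ℕ} (σ : Equiv.Perm (Fin n)), σ ∈ alternatingGroup (Fin n) →
    ∀ x : P.obj n, P.act σ x = x

/-- `P` is finitely generated: some finite set of operations lies in no proper suboperad. -/
def FinitelyGenerated (P : PreOperad.{v, u} k) : Prop :=
  ∃ X : Set (Σ n, P.obj n), X.Finite ∧ ∀ S : ∀ n, Submodule k (P.obj n),
    (∀ x ∈ X, x.2 ∈ S x.1) →
    P.one ∈ S 1 →
    (∀ {n : ℕ} (σ : Equiv.Perm (Fin n)), ∀ x ∈ S n, P.act σ x ∈ S n) →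
    (∀ {m n r : ℕ} (h : m + n = r + 1) (i : Fin m), ∀ x ∈ S m, ∀ y ∈ S n,
      P.comp h i x y ∈ S r) →
    ∀ n, S n = ⊤

/-- The operations on which the symmetric group acts trivially. -/
def trivPart (P : PreOperad.{v, u} k) (n : ℕ) : Submodule k (P.obj n) :=
  ⨅ σ : Equiv.Perm (Fin n), LinearMap.ker (P.act σ - LinearMap.id)

/-- The operations on which the symmetric group acts by the sign. -/
def signPart (P : PreOperad.{v, u} k) (n : ℕ) : Submodule k (P.obj n) :=
  ⨅ σ : Equiv.Perm (Fin n),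
    LinearMap.ker (P.act σ - ((Equiv.Perm.sign σ : ℤ) : k) • LinearMap.id)

theorem mem_trivPart {P : PreOperad.{v, u} k} {n : ℕ} {x : P.obj n} :
    x ∈ P.trivPart n ↔ ∀ σ, P.act σ x = x := by
  simp [trivPart, sub_eq_zero]

theorem mem_signPart {P : PreOperad.{v, u} k} {n : ℕ} {x : P.obj n} :
    x ∈ P.signPart n ↔ ∀ σ, P.act σ x = ((Equiv.Perm.sign σ : ℤ) : k) • x := by
  simp [signPart, sub_eq_zero]

end PreOperad

/-! ### Pseudo-graded-Perm algebras -/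

/-- A unital associative `ℕ`-graded `k`-algebra `A = ⨁ A_i` with a decomposition
`A_i = A_{i,e} ⊕ A_{i,o}` for every `i ≥ 1`. `part i 0` is `A_{i,e}` and `part i 1` is `A_{i,o}`;
there is no decomposition of `A_0`, and by convention `part 0 0` is `A_0` and `part 0 1` is `0`.
Thus `t(x) = t` for `x` in `part i t`. -/
structure TypedGradedAlgebra (k : Type u) [Field k] where
  carrier : Type v
  [ring : Ring carrier]
  [algebra : Algebra k carrier]
  grading : ℕ → Submodule k carrier
  [gradedAlgebra : GradedAlgebra grading]
  part : ℕ → Fin 2 → Submodule k carrier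
  part_sup : ∀ i, part i 0 ⊔ part i 1 = grading i
  part_disjoint : ∀ i, Disjoint (part i 0) (part i 1)
  part_zero : part 0 1 = ⊥

attribute [instance] TypedGradedAlgebra.ring TypedGradedAlgebra.algebra
  TypedGradedAlgebra.gradedAlgebra

namespace TypedGradedAlgebra

variable {k : Type u} [Field k]

/-- Morphisms: graded algebra homomorphisms that preserve types. -/
@[ext]
structure Hom (A B : TypedGradedAlgebra.{v, u} k) where
  toAlgHom : A.carrier →ₐ[k] B.carrier
  map_grading : ∀ i, ∀ x ∈ A.grading i, toAlgHom x ∈ B.grading i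
  map_part : ∀ i t, ∀ x ∈ A.part i t, toAlgHom x ∈ B.part i t

instance : Category (TypedGradedAlgebra.{v, u} k) where
  Hom := Hom
  id A := ⟨AlgHom.id k A.carrier, fun _ _ hx => hx, fun _ _ _ hx => hx⟩
  comp f g := ⟨g.toAlgHom.comp f.toAlgHom,
    fun i x hx => g.map_grading i _ (f.map_grading i x hx),
    fun i t x hx => g.map_part i t _ (f.map_part i t x hx)⟩

variable (A : TypedGradedAlgebra.{v, u} k)

theorem part_le (i : ℕ) (t : Fin 2) : A.part i t ≤ A.grading i := by
  rw [← A.part_sup i]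
  fin_cases t
  · exact le_sup_left
  · exact le_sup_right

theorem isCompl_part (i : ℕ) :
    IsCompl ((A.part i 0).comap (A.grading i).subtype)
      ((A.part i 1).comap (A.grading i).subtype) := by
  constructor
  · rw [Submodule.disjoint_def]
    intro x hx hy
    have := (Submodule.disjoint_def.1 (A.part_disjoint i)) x hx hy
    exact Subtype.ext this
  · rw [codisjoint_iff, eq_top_iff]
    rintro ⟨x, hx⟩ -
    rw [← A.part_sup i] at hx
    obtain ⟨y, hy, z, hz, rfl⟩ := Submodule.mem_sup.1 hx
    exact Submodule.mem_sup.2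
      ⟨⟨y, A.part_le i 0 hy⟩, hy, ⟨z, A.part_le i 1 hz⟩, hz, rfl⟩

/-- The involution `x ↦ x * Ξ`, extended to all of `A`: it is the identity on every `A_{i,e}`
and on `A_0`, and minus the identity on every `A_{i,o}`. -/
noncomputable def xi : A.carrier →ₗ[k] A.carrier :=
  DirectSum.toModule k ℕ A.carrier (fun i => (A.grading i).subtype ∘ₗ
      (Submodule.projection _ _ (A.isCompl_part i) -
        Submodule.projection _ _ (A.isCompl_part i).symm)) ∘ₗ
    (DirectSum.decomposeLinearEquiv A.grading).toLinearMap

theorem xi_of_mem {i : ℕ} {x : A.carrier} (hx : x ∈ A.grading i) :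
    A.xi x = (Submodule.projection _ _ (A.isCompl_part i) ⟨x, hx⟩ : A.grading i) -
      (Submodule.projection _ _ (A.isCompl_part i).symm ⟨x, hx⟩ : A.grading i) := by
  unfold xi
  rw [LinearMap.comp_apply, LinearEquiv.coe_coe, DirectSum.decomposeLinearEquiv_apply,
    DirectSum.decompose_of_mem _ hx, ← DirectSum.lof_eq_of k, DirectSum.toModule_lof]
  rfl

theorem xi_even {i : ℕ} {x : A.carrier} (hx : x ∈ A.part i 0) : A.xi x = x := by
  have hg := A.part_le i 0 hx
  have h1 : (⟨x, hg⟩ : A.grading i) ∈ (A.part i 0).comap (A.grading i).subtype := hx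
  rw [A.xi_of_mem hg, Submodule.projection_apply_of_mem_left (A.isCompl_part i) h1,
    (Submodule.projection_apply_eq_zero_iff (A.isCompl_part i).symm).2 h1]
  simp

theorem xi_odd {i : ℕ} {x : A.carrier} (hx : x ∈ A.part i 1) : A.xi x = -x := by
  have hg := A.part_le i 1 hx
  have h1 : (⟨x, hg⟩ : A.grading i) ∈ (A.part i 1).comap (A.grading i).subtype := hx
  rw [A.xi_of_mem hg, Submodule.projection_apply_of_mem_left (A.isCompl_part i).symm h1,
    (Submodule.projection_apply_eq_zero_iff (A.isCompl_part i)).2 h1]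
  simp

theorem xi_mem {i : ℕ} {x : A.carrier} (hx : x ∈ A.grading i) : A.xi x ∈ A.grading i := by
  rw [← A.part_sup i] at hx
  obtain ⟨y, hy, z, hz, rfl⟩ := Submodule.mem_sup.1 hx
  rw [map_add, A.xi_even hy, A.xi_odd hz]
  exact add_mem (A.part_le i 0 hy) (neg_mem (A.part_le i 1 hz))

theorem xi_pow_mem {i : ℕ} {x : A.carrier} (hx : x ∈ A.grading i) (e : ℕ) :
    (A.xi ^ e) x ∈ A.grading i := by
  induction e with
  | zero => exact hx
  | succ e ih =>
    rw [pow_succ']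
    exact A.xi_mem ih

theorem Hom.map_xi {A B : TypedGradedAlgebra.{v, u} k} (f : Hom A B) (x : A.carrier) :
    f.toAlgHom (A.xi x) = B.xi (f.toAlgHom x) := by
  induction x using DirectSum.Decomposition.inductionOn A.grading with
  | zero => simp
  | add x y hx hy => simp [hx, hy]
  | @homogeneous i x =>
    obtain ⟨x, hx⟩ := x
    rw [← A.part_sup i] at hx
    obtain ⟨y, hy, z, hz, rfl⟩ := Submodule.mem_sup.1 hx
    simp [A.xi_even hy, A.xi_odd hz, B.xi_even (f.map_part i 0 y hy),
      B.xi_odd (f.map_part i 1 z hz)]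

theorem Hom.map_xi_pow {A B : TypedGradedAlgebra.{v, u} k} (f : Hom A B) (e : ℕ)
    (x : A.carrier) : f.toAlgHom ((A.xi ^ e) x) = (B.xi ^ e) (f.toAlgHom x) := by
  induction e with
  | zero => rfl
  | succ e ih => rw [pow_succ', pow_succ', Module.End.mul_apply, Module.End.mul_apply,
      f.map_xi, ih]

/-- The sign `a(y, z)` for `y` of type `(i, s)` and `z` of type `(j, t)`: it is `-1` if both are of
odd type and both degrees are odd, and `1` otherwise. -/
def permSign (i : ℕ) (s : Fin 2) (j : ℕ) (t : Fin 2) : ℤ :=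
  if s = 1 ∧ t = 1 ∧ Odd i ∧ Odd j then -1 else 1

/-- A (locally finite) pseudo-graded-Perm algebra. -/
structure IsPGPerm : Prop where
  locallyFinite : ∀ i, Module.Finite k (A.grading i)
  /-- `⨁_{i ≥ 1} A_{i,e}` and `⨁_{i ≥ 1} A_{i,o}` are left ideals. -/
  left_ideal : ∀ (t : Fin 2) (a : A.carrier), ∀ x ∈ ⨆ i ≥ 1, A.part i t,
    a * x ∈ ⨆ i ≥ 1, A.part i t
  /-- `⨁_{i ≥ 2} A_{i,e}` and `⨁_{i ≥ 2} A_{i,o}` are two-sided ideals. -/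
  two_sided_ideal : ∀ (t : Fin 2) (a : A.carrier), ∀ x ∈ ⨆ i ≥ 2, A.part i t,
    a * x ∈ (⨆ i ≥ 2, A.part i t) ∧ x * a ∈ (⨆ i ≥ 2, A.part i t)
  /-- `x (y z) = a(y, z) x (z y)` for homogeneous `x`, `y`, `z` with `deg x ≥ 2`. -/
  perm : ∀ (l : ℕ) (r : Fin 2) (i : ℕ) (s : Fin 2) (j : ℕ) (t : Fin 2), 2 ≤ l →
    ∀ x ∈ A.part l r, ∀ y ∈ A.part i s, ∀ z ∈ A.part j t,
      x * (y * z) = permSign i s j t • (x * (z * y))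
  /-- The condition on `x ∈ A_1` and `y, z ∈ A_0`. -/
  xi_zero_zero : ∀ x ∈ A.grading 1, ∀ y ∈ A.grading 0, ∀ z ∈ A.grading 0,
    A.xi (A.xi (x * y) * z) = A.xi (A.xi x * z) * y
  /-- The condition on `x ∈ A_1`, `y ∈ A_0` and `z` homogeneous of positive degree. -/
  xi_zero_pos : ∀ x ∈ A.grading 1, ∀ y ∈ A.grading 0, ∀ (j : ℕ) (t : Fin 2), 1 ≤ j →
    ∀ z ∈ A.part j t, A.xi (x * y) * z = (A.xi x * z) * y
  /-- The condition on `x ∈ A_1` and `y`, `z` homogeneous of positive degree. -/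
  xi_pos_pos : ∀ x ∈ A.grading 1, ∀ (i : ℕ) (s : Fin 2) (j : ℕ) (t : Fin 2), 1 ≤ i → 1 ≤ j →
    ∀ y ∈ A.part i s, ∀ z ∈ A.part j t,
      (-1 : ℤ) ^ (j * (i - 1) * (s : ℕ)) • ((x * y) * z) =
        (-1 : ℤ) ^ ((j - 1) * (t : ℕ)) • ((A.xi x * z) * y)

/-! ### From algebras to operads -/

/-- The space of `n`-ary operations: `0` for `n = 0`, and `A_{n-1}` for `n ≥ 1`. -/
def arity : ℕ → Submodule k A.carrier
  | 0 => ⊥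
  | n + 1 => A.grading n

/-- The partial composition `x ∘_{i+1} y` of an `m`-ary operation `x` and an `n`-ary
operation `y`. If `m ≥ 3` it is `(-1)^{(n-1) i t(x)} x y`. If `m = 2` it is `x y` for `i = 0`, and for
`i = 1` it is `((x * Ξ) y) * Ξ` when `n = 1` and `(-1)^{n t(y)} (x * Ξ) y` when `n ≥ 2`.
If `m = 1` it is `x y`. The signs `(-1)^{e t(x)} x` are written as `(A.xi ^ e) x`. -/
noncomputable def compFun (m n : ℕ) (i : Fin m) (x y : A.carrier) : A.carrier :=
  if 3 ≤ m then (A.xi ^ ((n - 1) * (i : ℕ))) x * y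
  else if (i : ℕ) = 0 then x * y
  else if n = 1 then A.xi (A.xi x * y)
  else A.xi x * (A.xi ^ n) y

theorem compFun_mem {m n r : ℕ} (h : m + n = r + 1) (i : Fin m) {x y : A.carrier}
    (hx : x ∈ A.arity m) (hy : y ∈ A.arity n) : A.compFun m n i x y ∈ A.arity r := by
  obtain _ | m := m
  · exact i.elim0
  obtain _ | n := n
  · have hy : y = 0 := hy
    subst hy
    simp [compFun]
  obtain _ | r := r
  · omega
  obtain rfl : m + n = r := by omega
  simp only [arity] at hx hy ⊢
  unfold compFun
  split_ifs
  · exact SetLike.mul_mem_graded (A.xi_pow_mem hx _) hy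
  · exact SetLike.mul_mem_graded hx hy
  · exact A.xi_mem (SetLike.mul_mem_graded (A.xi_mem hx) hy)
  · exact SetLike.mul_mem_graded (A.xi_mem hx) (A.xi_pow_mem hy _)

theorem compFun_add_left {m n : ℕ} (i : Fin m) (x x' y : A.carrier) :
    A.compFun m n i (x + x') y = A.compFun m n i x y + A.compFun m n i x' y := by
  unfold compFun
  split_ifs <;> simp [add_mul]

theorem compFun_smul_left {m n : ℕ} (i : Fin m) (c : k) (x y : A.carrier) :
    A.compFun m n i (c • x) y = c • A.compFun m n i x y := by
  unfold compFun
  split_ifs <;> simp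

theorem compFun_add_right {m n : ℕ} (i : Fin m) (x y y' : A.carrier) :
    A.compFun m n i x (y + y') = A.compFun m n i x y + A.compFun m n i x y' := by
  unfold compFun
  split_ifs <;> simp [mul_add]

theorem compFun_smul_right {m n : ℕ} (i : Fin m) (c : k) (x y : A.carrier) :
    A.compFun m n i x (c • y) = c • A.compFun m n i x y := by
  unfold compFun
  split_ifs <;> simp

/-- The action `x * σ`: trivial on `A_0` and on `A_{i,e}`, and by the sign of `σ` on `A_{i,o}`. -/
noncomputable def actFun {n : ℕ} (σ : Equiv.Perm (Fin n)) : A.carrier →ₗ[k] A.carrier :=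
  if Equiv.Perm.sign σ = 1 then LinearMap.id else A.xi

theorem actFun_mem {n : ℕ} (σ : Equiv.Perm (Fin n)) {x : A.carrier} (hx : x ∈ A.arity n) :
    A.actFun σ x ∈ A.arity n := by
  unfold actFun
  split_ifs
  · exact hx
  · obtain _ | n := n
    · have hx : x = 0 := hx
      subst hx
      simp
    · exact A.xi_mem hx

/-- The operad structure attached to `A`. -/
noncomputable def toPreOperad : PreOperad.{v, u} k where
  obj n := A.arity n
  act σ := (A.actFun σ).restrict fun _ hx => A.actFun_mem σ hx
  one := ⟨1, SetLike.one_mem_graded A.grading⟩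
  comp {m n _} h i := LinearMap.mk₂ k
    (fun x y => ⟨A.compFun m n i x y, A.compFun_mem h i x.2 y.2⟩)
    (fun x x' y => Subtype.ext (A.compFun_add_left i x x' y))
    (fun c x y => Subtype.ext (A.compFun_smul_left i c x y))
    (fun x y y' => Subtype.ext (A.compFun_add_right i x y y'))
    (fun c x y => Subtype.ext (A.compFun_smul_right i c x y))

theorem Hom.map_arity {A B : TypedGradedAlgebra.{v, u} k} (f : Hom A B) (n : ℕ) {x : A.carrier}
    (hx : x ∈ A.arity n) : f.toAlgHom x ∈ B.arity n := by
  obtain _ | n := n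
  · have hx : x = 0 := hx
    subst hx
    simp
  · exact f.map_grading n x hx

end TypedGradedAlgebra

/-- Pseudo-graded-Perm algebras, as a property of graded algebras with types. -/
def isPGPerm (k : Type u) [Field k] : ObjectProperty (TypedGradedAlgebra.{v, u} k) :=
  fun A => A.IsPGPerm

/-- The category of pseudo-graded-Perm algebras. -/
abbrev PGPermAlgebra (k : Type u) [Field k] := (isPGPerm.{v, u} k).FullSubcategory

/-- `𝔸`-trivial (reduced, locally finite, symmetric) operads, as a property of operad data. -/
def isATrivOperad (k : Type u) [Field k] : ObjectProperty (PreOperad.{v, u} k) :=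
  fun P => P.IsATrivOperad

/-- The category of `𝔸`-trivial (reduced, locally finite, symmetric) operads. -/
abbrev ATrivOperad (k : Type u) [Field k] := (isATrivOperad.{v, u} k).FullSubcategory

/-- The functor `A ↦ G(A)` from pseudo-graded-Perm algebras to operad data. On morphisms it
restricts a homomorphism to the graded pieces. -/
noncomputable def preG (k : Type u) [Field k] : PGPermAlgebra.{v, u} k ⥤ PreOperad.{v, u} k where
  obj A := A.obj.toPreOperad
  map {A B} f :=
    { app := fun n => f.hom.toAlgHom.toLinearMap.restrict fun _ hx => f.hom.map_arity n hx
      map_act := fun σ x => by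
        apply Subtype.ext
        change f.hom.toAlgHom (A.obj.actFun σ x.1) = B.obj.actFun σ (f.hom.toAlgHom x.1)
        unfold TypedGradedAlgebra.actFun
        split_ifs
        · rfl
        · exact f.hom.map_xi x.1
      map_one := Subtype.ext (map_one f.hom.toAlgHom)
      map_comp := fun {m n r} h i x y => by
        apply Subtype.ext
        change f.hom.toAlgHom (A.obj.compFun m n i x.1 y.1) =
          B.obj.compFun m n i (f.hom.toAlgHom x.1) (f.hom.toAlgHom y.1)
        unfold TypedGradedAlgebra.compFun
        split_ifs <;> simp [f.hom.map_xi, f.hom.map_xi_pow] }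

/-! ### From operads to algebras -/

namespace ATrivOperad

variable {k : Type u} [Field k] (P : ATrivOperad.{v, u} k)

/-- The graded pieces `A_i = P(i+1)`. -/
abbrev piece (i : ℕ) : Type v := P.obj.obj (i + 1)

theorem comp_heq (P : PreOperad.{v, u} k) {m n r r' : ℕ} (h : m + n = r + 1) (h' : m + n = r' + 1)
    (i : Fin m) (x : P.obj m) (y : P.obj n) :
    (⟨r, P.comp h i x y⟩ : Σ r, P.obj r) = ⟨r', P.comp h' i x y⟩ := by
  obtain rfl : r = r' := by omega
  rfl

theorem piece_ext {P : ATrivOperad.{v, u} k} {i j : ℕ} {x : P.piece i} {y : P.piece j}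
    (h : (⟨i + 1, x⟩ : Σ n, P.obj.obj n) = ⟨j + 1, y⟩) :
    (GradedMonoid.mk i x : GradedMonoid P.piece) = GradedMonoid.mk j y := by
  obtain rfl : i = j := by
    have := congrArg Sigma.fst h
    simpa using this
  obtain rfl : x = y := by simpa using h
  rfl

theorem mul_arity (i j : ℕ) : i + 1 + (j + 1) = i + j + 1 + 1 := by omega

/-- The product `x · y = x ∘_1 y`. -/
instance : GradedMonoid.GMul P.piece where
  mul {i j} x y := P.obj.comp (mul_arity i j) 0 x y

instance : GradedMonoid.GOne P.piece where
  one := P.obj.one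

/-- The product `x · y = x ∘_1 y` makes `⨁ P(i+1)` a graded ring. -/
instance : DirectSum.GRing P.piece where
  mul_zero _ := map_zero _
  zero_mul _ := by simp [GradedMonoid.GMul.mul]
  mul_add _ _ _ := map_add _ _ _
  add_mul _ _ _ := by simp [GradedMonoid.GMul.mul]
  one_mul := by
    rintro ⟨i, x⟩
    refine piece_ext ((comp_heq P.obj _ (Nat.add_comm 1 (i + 1)) 0 P.obj.one x).trans ?_)
    rw [P.property.one_comp]
  mul_one := by
    rintro ⟨i, x⟩
    refine piece_ext ((comp_heq P.obj _ rfl 0 x P.obj.one).trans ?_)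
    rw [P.property.comp_one]
  mul_assoc := by
    rintro ⟨i, x⟩ ⟨j, y⟩ ⟨l, z⟩
    have h : i + 1 + (j + l + 1) = i + j + l + 1 + 1 := by omega
    refine piece_ext (Eq.trans ?_ (comp_heq P.obj h (mul_arity i (j + l)) 0 x
      (P.obj.comp (mul_arity j l) 0 y z)))
    exact congrArg (Sigma.mk _) (P.property.comp_seq (mul_arity i j) (mul_arity (i + j) l)
      (mul_arity j l) h 0 0 0 rfl x y z)
  natCast n := n • P.obj.one
  natCast_zero := zero_smul _ _
  natCast_succ n := succ_nsmul _ n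
  intCast z := z • P.obj.one
  intCast_ofNat n := natCast_zsmul _ n
  intCast_negSucc_ofNat n := negSucc_zsmul _ n

instance : DirectSum.GAlgebra k P.piece where
  toFun := (LinearMap.toSpanSingleton k (P.piece 0) P.obj.one).toAddMonoidHom
  map_one := one_smul _ _
  map_mul a b := by
    refine piece_ext ?_
    change _ = (⟨1, P.obj.comp rfl 0 (a • P.obj.one) (b • P.obj.one)⟩ : Σ n, P.obj.obj n)
    rw [map_smul, LinearMap.map_smul, LinearMap.smul_apply, P.property.comp_one, smul_smul,
      mul_comm b a]
    rfl
  commutes := by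
    rintro a ⟨i, x⟩
    refine piece_ext (((comp_heq P.obj _ (Nat.add_comm 1 (i + 1)) 0 (a • P.obj.one) x).trans
      ?_).trans (comp_heq P.obj rfl _ 0 x (a • P.obj.one)))
    rw [LinearMap.map_smul, map_smul, LinearMap.smul_apply, P.property.one_comp,
      P.property.comp_one]
  smul_def := by
    rintro a ⟨i, x⟩
    refine piece_ext (Eq.symm
      ((comp_heq P.obj _ (Nat.add_comm 1 (i + 1)) 0 (a • P.obj.one) x).trans ?_))
    rw [LinearMap.map_smul, LinearMap.smul_apply, P.property.one_comp]

/-- The underlying algebra `⨁ P(i+1)`. -/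
abbrev total : Type v := ⨁ i, P.piece i

/-- The degree `i` part `P(i+1)` of `⨁ P(i+1)`. -/
noncomputable def grading (i : ℕ) : Submodule k P.total :=
  LinearMap.range (DirectSum.lof k ℕ P.piece i)

noncomputable instance : GradedAlgebra P.grading where
  one_mem := ⟨P.obj.one, rfl⟩
  mul_mem := by
    rintro i j _ _ ⟨x, rfl⟩ ⟨y, rfl⟩
    exact ⟨GradedMonoid.GMul.mul x y, (DirectSum.of_mul_of x y).symm⟩
  decompose' := DirectSum.toModule k ℕ _ fun i =>
    DirectSum.lof k ℕ (fun i => P.grading i) i ∘ₗ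
      (DirectSum.lof k ℕ P.piece i).codRestrict (P.grading i) (fun x => ⟨x, rfl⟩)
  left_inv x := by
    induction x using DirectSum.induction_on with
    | zero => simp
    | of i x =>
      rw [← DirectSum.lof_eq_of k, DirectSum.toModule_lof, LinearMap.comp_apply,
        DirectSum.lof_eq_of, DirectSum.coeAddMonoidHom_of]
      rfl
    | add x y hx hy => rw [map_add, map_add, hx, hy]
  right_inv x := by
    induction x using DirectSum.induction_on with
    | zero => simp
    | of i x =>
      obtain ⟨_, x, rfl⟩ := x
      rw [DirectSum.coeAddMonoidHom_of, DirectSum.toModule_lof]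
      rfl
    | add x y hx hy => rw [map_add, map_add, hx, hy]

/-- `A_{i,e} = P(i+1)_triv` and `A_{i,o} = P(i+1)_sign` for `i ≥ 1`; by convention the parts in
degree `0` are `A_0 = P(1)` (all of which is symmetric group invariant) and `0`. -/
noncomputable def part (i : ℕ) (t : Fin 2) : Submodule k P.total :=
  if t = 0 then (P.obj.trivPart (i + 1)).map (DirectSum.lof k ℕ P.piece i)
  else if i = 0 then ⊥ else (P.obj.signPart (i + 1)).map (DirectSum.lof k ℕ P.piece i)

theorem trivPart_one : P.obj.trivPart 1 = ⊤ := by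
  refine eq_top_iff.2 fun x _ => PreOperad.mem_trivPart.2 fun σ => ?_
  rw [Subsingleton.elim σ 1, P.property.act_one]

theorem act_even {n : ℕ} (σ : Equiv.Perm (Fin n)) (hσ : Equiv.Perm.sign σ = 1) (x : P.obj.obj n) :
    P.obj.act σ x = x :=
  P.property.aTriv σ (Equiv.Perm.mem_alternatingGroup.2 hσ) x

theorem act_odd {n : ℕ} (σ τ : Equiv.Perm (Fin n)) (hσ : Equiv.Perm.sign σ = -1)
    (hτ : Equiv.Perm.sign τ = -1) (x : P.obj.obj n) : P.obj.act σ x = P.obj.act τ x := by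
  have h : σ = (σ * τ⁻¹) * τ := by group
  rw [h, P.property.act_mul, P.act_even (σ * τ⁻¹) (by simp [hσ, hτ])]

theorem act_odd_odd {n : ℕ} (σ τ : Equiv.Perm (Fin n)) (hσ : Equiv.Perm.sign σ = -1)
    (hτ : Equiv.Perm.sign τ = -1) (x : P.obj.obj n) : P.obj.act σ (P.obj.act τ x) = x := by
  rw [← P.property.act_mul, P.act_even (τ * σ) (by simp [hσ, hτ])]

theorem triv_sup_sign (hk : ringChar k ≠ 2) (n : ℕ) :
    P.obj.trivPart (n + 2) ⊔ P.obj.signPart (n + 2) = ⊤ := by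
  have h2 : (2 : k) ≠ 0 := Ring.two_ne_zero hk
  refine eq_top_iff.2 fun x _ => ?_
  have hτ : Equiv.Perm.sign (Equiv.swap (0 : Fin (n + 2)) 1) = -1 :=
    Equiv.Perm.sign_swap (by simp)
  generalize Equiv.swap (0 : Fin (n + 2)) 1 = τ at hτ
  refine Submodule.mem_sup.2 ⟨(2 : k)⁻¹ • (x + P.obj.act τ x), ?_,
    (2 : k)⁻¹ • (x - P.obj.act τ x), ?_, ?_⟩
  · refine PreOperad.mem_trivPart.2 fun σ => ?_
    rcases Int.units_eq_one_or (Equiv.Perm.sign σ) with hσ | hσ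
    · exact P.act_even σ hσ _
    · rw [map_smul, map_add, P.act_odd σ τ hσ hτ x, P.act_odd_odd σ τ hσ hτ,
        add_comm (P.obj.act τ x) x]
  · refine PreOperad.mem_signPart.2 fun σ => ?_
    rcases Int.units_eq_one_or (Equiv.Perm.sign σ) with hσ | hσ
    · rw [P.act_even σ hσ, hσ]
      simp
    · rw [map_smul, map_sub, P.act_odd σ τ hσ hτ x, P.act_odd_odd σ τ hσ hτ, hσ]
      simp only [Units.val_neg, Units.val_one, Int.cast_neg, Int.cast_one, neg_smul, one_smul,
        ← smul_neg, neg_sub]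
  · rw [← smul_add, add_add_sub_cancel, ← two_smul k x, smul_smul, inv_mul_cancel₀ h2, one_smul]

theorem triv_disjoint_sign (hk : ringChar k ≠ 2) (n : ℕ) :
    Disjoint (P.obj.trivPart (n + 2)) (P.obj.signPart (n + 2)) := by
  have h2 : (2 : k) ≠ 0 := Ring.two_ne_zero hk
  refine Submodule.disjoint_def.2 fun x hx hy => ?_
  have hτ : Equiv.Perm.sign (Equiv.swap (0 : Fin (n + 2)) 1) = -1 :=
    Equiv.Perm.sign_swap (by simp)
  have h := PreOperad.mem_signPart.1 hy (Equiv.swap 0 1)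
  rw [PreOperad.mem_trivPart.1 hx, hτ] at h
  have h3 : (2 : k) • x = 0 := by
    rw [two_smul]
    nth_rewrite 1 [h]
    simp
  exact (smul_eq_zero.1 h3).resolve_left h2

/-- The graded algebra with types attached to an `𝔸`-trivial operad. -/
noncomputable def toTypedGradedAlgebra (hk : ringChar k ≠ 2) : TypedGradedAlgebra.{v, u} k where
  carrier := P.total
  grading := P.grading
  part := P.part
  part_sup i := by
    obtain _ | n := i
    · simp [part, trivPart_one, grading]
    · simp only [part, if_true, if_neg (one_ne_zero (α := Fin 2)), if_neg (Nat.succ_ne_zero n),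
        ← Submodule.map_sup, P.triv_sup_sign hk n, Submodule.map_top, grading]
  part_disjoint i := by
    obtain _ | n := i
    · simp [part]
    · have h : Function.Injective (DirectSum.lof k ℕ P.piece (n + 1)) := DirectSum.of_injective _
      simpa [part] using Submodule.disjoint_map h (P.triv_disjoint_sign hk n)
  part_zero := by simp [part]

variable {P} {Q : ATrivOperad.{v, u} k}

/-- The linear map `⨁ P(i+1) → ⨁ Q(i+1)` induced by a morphism of operads. -/
noncomputable def totalMap (f : P ⟶ Q) : P.total →ₗ[k] Q.total :=
  DirectSum.lmap fun i => f.hom.app (i + 1)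

theorem totalMap_lof (f : P ⟶ Q) (i : ℕ) (x : P.piece i) :
    totalMap f (DirectSum.lof k ℕ P.piece i x) = DirectSum.lof k ℕ Q.piece i (f.hom.app (i + 1) x) :=
  DirectSum.lmap_lof _ _ _

theorem totalMap_mul (f : P ⟶ Q) (x y : P.total) :
    totalMap f (x * y) = totalMap f x * totalMap f y := by
  induction x using DirectSum.induction_on with
  | zero => simp
  | add x x' hx hx' => simp only [add_mul, map_add, hx, hx']
  | of i x =>
    induction y using DirectSum.induction_on with
    | zero => simp
    | add y y' hy hy' => simp only [mul_add, map_add, hy, hy']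
    | of j y =>
      rw [DirectSum.of_mul_of]
      simp only [← DirectSum.lof_eq_of k, totalMap_lof]
      simp only [DirectSum.lof_eq_of, DirectSum.of_mul_of]
      exact congrArg _ (f.hom.map_comp _ _ _ _)

theorem totalMap_one (f : P ⟶ Q) : totalMap f 1 = 1 :=
  (totalMap_lof f 0 P.obj.one).trans
    (congrArg (DirectSum.lof k ℕ Q.piece 0) f.hom.map_one)

theorem totalMap_part (f : P ⟶ Q) (i : ℕ) (t : Fin 2) {x : P.total} (hx : x ∈ P.part i t) :
    totalMap f x ∈ Q.part i t := by
  unfold part at hx ⊢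
  split_ifs at hx ⊢
  · obtain ⟨y, hy, rfl⟩ := hx
    refine ⟨_, PreOperad.mem_trivPart.2 fun σ => ?_, (totalMap_lof f i y).symm⟩
    rw [← f.hom.map_act, PreOperad.mem_trivPart.1 hy]
  · rw [(Submodule.mem_bot k).1 hx, map_zero]
    exact zero_mem _
  · obtain ⟨y, hy, rfl⟩ := hx
    refine ⟨_, PreOperad.mem_signPart.2 fun σ => ?_, (totalMap_lof f i y).symm⟩
    rw [← f.hom.map_act, PreOperad.mem_signPart.1 hy, map_smul]

end ATrivOperad

/-- The functor `P ↦ F(P)` from `𝔸`-trivial operads to graded algebras with types. On morphisms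
it is the direct sum of the components. -/
noncomputable def preF (k : Type u) [Field k] (hk : ringChar k ≠ 2) :
    ATrivOperad.{v, u} k ⥤ TypedGradedAlgebra.{v, u} k where
  obj P := P.toTypedGradedAlgebra hk
  map {P Q} f :=
    { toAlgHom := AlgHom.ofLinearMap (ATrivOperad.totalMap f) (ATrivOperad.totalMap_one f)
        (ATrivOperad.totalMap_mul f)
      map_grading := by
        rintro i _ ⟨x, rfl⟩
        exact ⟨_, (ATrivOperad.totalMap_lof f i x).symm⟩
      map_part := by
        intro i t x hx
        exact ATrivOperad.totalMap_part f i t hx }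
  map_id P := by
    refine TypedGradedAlgebra.Hom.ext (AlgHom.toLinearMap_injective ?_)
    refine DirectSum.linearMap_ext k fun i => LinearMap.ext fun x => ?_
    exact ATrivOperad.totalMap_lof (𝟙 P) i x
  map_comp {P Q R} f g := by
    refine TypedGradedAlgebra.Hom.ext (AlgHom.toLinearMap_injective ?_)
    refine DirectSum.linearMap_ext k fun i => LinearMap.ext fun x => ?_
    refine (ATrivOperad.totalMap_lof (f ≫ g) i x).trans ?_
    refine (ATrivOperad.totalMap_lof g i (f.hom.app (i + 1) x)).symm.trans ?_
    exact congrArg (ATrivOperad.totalMap g) (ATrivOperad.totalMap_lof f i x).symm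

/-! ### The pseudo-graded-Perm axioms in terms of the involution -/

namespace TypedGradedAlgebra

variable {k : Type u} [Field k] (A : TypedGradedAlgebra.{v, u} k)

/-! When even permutations act trivially, the symmetric group acts on each `P(n)` with `n ≥ 2`
through a single involution, and all odd permutations act alike. Since 2 is invertible, splitting a
graded piece into types amounts to giving this involution, here `xi`, and the types are its
eigenspaces. The axioms on types then become identities in `xi`, collected in `XiAxioms`: ideal
conditions say that `xi` commutes with multiplication on one side, and sign rules become powers of
`xi`. `IsPGPerm.xiAxioms` and `XiAxioms.isPGPerm` prove the equivalence, local finiteness aside.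

The bridge to operads is that `x ∘_1 y`, together with the action, determines every `x ∘_i y`: a
transposition moves input `i` to the first place, and equivariance carries it through the
composition as a block permutation. Only the sign of that block permutation matters;
`sign_outerPerm` computes it. The resulting formula is `compFun` (`ATrivOperad.ofOp_comp`). Inner
equivariance makes `xi` commute with left multiplication as soon as the right factor has degree at
least 1. Commuting with right multiplication needs an odd permutation fixing the first input, so
arity at least 3; this is why `A_1` obeys separate rules.

Under this dictionary sequential composition at the first inputs is associativity, and parallel
composition is the permutation rule in degree at least 2 and the three special rules in degree 1.
Read one way this gives `IsPGPerm.isATrivOperad`, read the other way `ATrivOperad.xiAxioms`. Both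
constructions keep the underlying graded pieces, so the unit and counit are the evident
identifications.

For finite generation, the product is a partial composition, so components of algebra generators
generate the operad. Conversely, operadic generators, their images under `xi`, and spanning sets of
`A_0` and `A_1` generate the algebra. -/

theorem grading_induction {i : ℕ} {p : A.carrier → Prop}
    (hp : ∀ t, ∀ x ∈ A.part i t, p x) (hadd : ∀ x y, p x → p y → p (x + y))
    {x : A.carrier} (hx : x ∈ A.grading i) : p x := by
  rw [← A.part_sup i] at hx
  obtain ⟨y, hy, z, hz, rfl⟩ := Submodule.mem_sup.1 hx
  exact hadd _ _ (hp 0 y hy) (hp 1 z hz)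

theorem xi_part {i : ℕ} (t : Fin 2) {x : A.carrier} (hx : x ∈ A.part i t) :
    A.xi x = (-1 : ℤ) ^ (t : ℕ) • x := by
  fin_cases t
  · simpa using A.xi_even hx
  · simpa using A.xi_odd hx

theorem xi_xi (x : A.carrier) : A.xi (A.xi x) = x := by
  induction x using DirectSum.Decomposition.inductionOn A.grading with
  | zero => simp
  | add x y hx hy => simp [hx, hy]
  | @homogeneous i x =>
    obtain ⟨x, hx⟩ := x
    refine A.grading_induction (p := fun x => A.xi (A.xi x) = x) (fun t x hx => ?_)
      (fun x y hx hy => ?_) hx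
    · match t, hx with
      | 0, hx => simp [A.xi_even hx]
      | 1, hx => simp [A.xi_odd hx]
    · simp [hx, hy]

theorem grading_zero : A.grading 0 = A.part 0 0 := by
  rw [← A.part_sup 0, A.part_zero, sup_bot_eq]

theorem xi_pow_xi_pow (a b : ℕ) (x : A.carrier) :
    (A.xi ^ a) ((A.xi ^ b) x) = (A.xi ^ (a + b)) x := by
  rw [pow_add, Module.End.mul_apply]

theorem xi_eq_pow (x : A.carrier) : A.xi x = (A.xi ^ 1) x := by rw [pow_one]

theorem xi_sq : A.xi ^ 2 = 1 :=
  LinearMap.ext fun x => by rw [pow_two, Module.End.mul_apply, A.xi_xi, Module.End.one_apply]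

theorem xi_pow_of_even {e : ℕ} (h : Even e) : A.xi ^ e = 1 := by
  obtain ⟨d, rfl⟩ := h
  rw [← two_mul, pow_mul, A.xi_sq, one_pow]

theorem xi_pow_of_odd {e : ℕ} (h : Odd e) : A.xi ^ e = A.xi := by
  obtain ⟨d, rfl⟩ := h
  rw [pow_succ, pow_mul, A.xi_sq, one_pow, one_mul]

theorem xi_pow_congr {a b : ℕ} (h : Even (a + b)) : A.xi ^ a = A.xi ^ b := by
  rcases Nat.even_or_odd a with ha | ha
  · rw [A.xi_pow_of_even ha, A.xi_pow_of_even ((Nat.even_add.1 h).1 ha)]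
  · rw [A.xi_pow_of_odd ha, A.xi_pow_of_odd (by grind)]

theorem xi_pow_apply_congr {a b : ℕ} (h : Even (a + b)) {x y : A.carrier} (hxy : x = y) :
    (A.xi ^ a) x = (A.xi ^ b) y := by
  rw [A.xi_pow_congr h, hxy]

theorem xi_pow_part {i : ℕ} (e : ℕ) (t : Fin 2) {x : A.carrier} (hx : x ∈ A.part i t) :
    (A.xi ^ e) x = (-1 : ℤ) ^ (e * (t : ℕ)) • x := by
  rcases Nat.even_or_odd e with he | he
  · rw [A.xi_pow_of_even he, (he.mul_right _).neg_one_pow, one_smul, Module.End.one_apply]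
  · rw [A.xi_pow_of_odd he, A.xi_part t hx, pow_mul, he.neg_one_pow]

/-- The component of the other type is multiplied by the opposite sign, so twice it vanishes. This
is the step that recovers types from the involution, and it needs 2 to be invertible. -/
theorem mem_part_of_xi (hk : ringChar k ≠ 2) {i : ℕ} (t : Fin 2) {x : A.carrier}
    (hx : x ∈ A.grading i) (h : A.xi x = (-1 : ℤ) ^ (t : ℕ) • x) : x ∈ A.part i t := by
  have h2 : (2 : k) ≠ 0 := Ring.two_ne_zero hk
  rw [← A.part_sup i] at hx
  obtain ⟨y, hy, z, hz, rfl⟩ := Submodule.mem_sup.1 hx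
  rw [map_add, A.xi_even hy, A.xi_odd hz] at h
  fin_cases t
  · have h3 : (2 : k) • z = 0 := by
      simp only [pow_zero, one_smul, add_right_inj] at h
      rw [two_smul]
      nth_rewrite 1 [← h]
      simp
    rw [(smul_eq_zero.1 h3).resolve_left h2, add_zero]
    exact hy
  · have h3 : (2 : k) • y = 0 := by
      simp only [pow_one, neg_smul, one_smul, neg_add, add_left_inj] at h
      rw [two_smul]
      nth_rewrite 1 [h]
      simp
    rw [(smul_eq_zero.1 h3).resolve_left h2, zero_add]
    exact hz

/-- The axioms of a pseudo-graded-Perm algebra, apart from local finiteness, in terms of the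
involution `xi`. -/
structure XiAxioms : Prop where
  xi_mul_right : ∀ (p i : ℕ), 1 ≤ i → ∀ a ∈ A.grading p, ∀ x ∈ A.grading i,
    A.xi (a * x) = a * A.xi x
  xi_mul_left : ∀ (i p : ℕ), 2 ≤ i → ∀ x ∈ A.grading i, ∀ a ∈ A.grading p,
    A.xi (x * a) = A.xi x * a
  perm : ∀ (l i j : ℕ), 2 ≤ l → ∀ x ∈ A.grading l, ∀ y ∈ A.grading i, ∀ z ∈ A.grading j,
    x * y * z = (A.xi ^ (i * j)) (x * z * y)
  zero_zero : ∀ x ∈ A.grading 1, ∀ y ∈ A.grading 0, ∀ z ∈ A.grading 0,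
    A.xi (A.xi (x * y) * z) = A.xi (A.xi x * z) * y
  zero_pos : ∀ (j : ℕ), 1 ≤ j → ∀ x ∈ A.grading 1, ∀ y ∈ A.grading 0,
    ∀ z ∈ A.grading j, A.xi (x * y) * z = A.xi x * z * y
  pos_pos : ∀ (i j : ℕ), 1 ≤ i → 1 ≤ j → ∀ x ∈ A.grading 1, ∀ y ∈ A.grading i,
    ∀ z ∈ A.grading j,
    (A.xi ^ (j * (i + 1))) (x * y) * z = A.xi x * (A.xi ^ (j + 1)) z * y

variable {A}

/-- Turns the ideal conditions, which are memberships in infinite sums, into eigenvector equations.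
-/
theorem xi_of_mem_iSup {n : ℕ} (t : Fin 2) {x : A.carrier}
    (hx : x ∈ ⨆ i ≥ n, A.part i t) : A.xi x = (-1 : ℤ) ^ (t : ℕ) • x := by
  have h : (⨆ i ≥ n, A.part i t) ≤
      LinearMap.eqLocus A.xi ((-1 : ℤ) ^ (t : ℕ) • LinearMap.id) :=
    iSup₂_le fun i _ y hy => A.xi_part t hy
  exact h hx

theorem mem_iSup_part {n i : ℕ} (hi : n ≤ i) {t : Fin 2} {x : A.carrier} (hx : x ∈ A.part i t) :
    x ∈ ⨆ i ≥ n, A.part i t :=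
  Submodule.mem_iSup_of_mem i (Submodule.mem_iSup_of_mem hi hx)

/-- Moving `xi` from one factor to the other changes the sign, so the product equals its own
negative. -/
theorem mul_eq_zero_of_xi (hk : ringChar k ≠ 2) {s t : Fin 2} (hst : s ≠ t) {x y : A.carrier}
    (h : A.xi x * y = x * A.xi y) (hx : A.xi x = (-1 : ℤ) ^ (s : ℕ) • x)
    (hy : A.xi y = (-1 : ℤ) ^ (t : ℕ) • y) : x * y = 0 := by
  have h2 : (2 : k) ≠ 0 := Ring.two_ne_zero hk
  have h4 : (2 : k) • (x * y) = 0 := by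
    rw [hx, hy] at h
    rw [two_smul]
    match s, t with
    | 0, 0 => exact absurd rfl hst
    | 1, 1 => exact absurd rfl hst
    | 0, 1 => exact eq_neg_iff_add_eq_zero.1 (by simpa using h)
    | 1, 0 => exact neg_eq_iff_add_eq_zero.1 (by simpa using h)
  exact (smul_eq_zero.1 h4).resolve_left h2

theorem IsPGPerm.xiAxioms (hk : ringChar k ≠ 2) (h : A.IsPGPerm) : A.XiAxioms := by
  have right : ∀ (i : ℕ), 1 ≤ i → ∀ (a : A.carrier), ∀ x ∈ A.grading i,
      A.xi (a * x) = a * A.xi x := fun i hi a x hx => by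
    refine A.grading_induction (p := fun x => A.xi (a * x) = a * A.xi x) (fun t x hx => ?_)
      (fun x y hx hy => ?_) hx
    · rw [A.xi_part t hx, xi_of_mem_iSup t (h.left_ideal t a x (mem_iSup_part hi hx)),
        mul_smul_comm]
    · simp only [mul_add, map_add, hx, hy]
  have left : ∀ (i : ℕ), 2 ≤ i → ∀ x ∈ A.grading i, ∀ (a : A.carrier),
      A.xi (x * a) = A.xi x * a := fun i hi x hx a => by
    refine A.grading_induction (p := fun x => A.xi (x * a) = A.xi x * a) (fun t x hx => ?_)
      (fun x y hx hy => ?_) hx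
    · rw [A.xi_part t hx, xi_of_mem_iSup t (h.two_sided_ideal t a x (mem_iSup_part hi hx)).2,
        smul_mul_assoc]
    · simp only [add_mul, map_add, hx, hy]
  refine ⟨fun p i hi a _ x hx => right i hi a x hx, fun i p hi x hx a _ => left i hi x hx a,
    fun l i j hl x hx y hy z hz => ?_, h.xi_zero_zero, fun j hj x hx y hy z hz => ?_,
    fun i j hi hj x hx y hy z hz => ?_⟩
  · refine A.grading_induction (p := fun x => x * y * z = (A.xi ^ (i * j)) (x * z * y))
      (fun r x hx => ?_) (fun x x' hx hx' => ?_) hx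
    swap
    · simp only [add_mul, map_add, hx, hx']
    refine A.grading_induction (p := fun y => x * y * z = (A.xi ^ (i * j)) (x * z * y))
      (fun s y hy => ?_) (fun x x' hx hx' => ?_) hy
    swap
    · simp only [add_mul, mul_add, map_add, hx, hx']
    refine A.grading_induction (p := fun z => x * y * z = (A.xi ^ (i * j)) (x * z * y))
      (fun t z hz => ?_) (fun x x' hx hx' => ?_) hz
    swap
    · simp only [add_mul, mul_add, map_add, hx, hx']
    have hp := h.perm l r i s j t hl x hx y hy z hz
    rw [← mul_assoc, ← mul_assoc] at hp
    rw [hp]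
    rcases Nat.even_or_odd (i * j) with he | he
    · rw [A.xi_pow_of_even he, permSign, if_neg, one_smul, Module.End.one_apply]
      rintro ⟨-, -, h1, h2⟩
      exact Nat.not_even_iff_odd.2 (h1.mul h2) he
    · obtain ⟨hi, hj⟩ := Nat.odd_mul.1 he
      rw [A.xi_pow_of_odd he, right i hi.pos _ y (A.part_le _ _ hy)]
      have hxz : x * z ∈ A.grading (l + j) :=
        SetLike.mul_mem_graded (A.part_le _ _ hx) (A.part_le _ _ hz)
      have hz' : A.xi (x * z) = (-1 : ℤ) ^ (t : ℕ) • (x * z) := by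
        rw [right j hj.pos _ z (A.part_le _ _ hz), A.xi_part t hz, mul_smul_comm]
      by_cases hst : t = s
      · subst hst
        rw [A.xi_part t hy, permSign]
        match t with
        | 0 => simp
        | 1 => simp [hi, hj]
      · rw [mul_eq_zero_of_xi hk hst _ hz' (A.xi_part s hy), smul_zero, A.xi_part s hy,
          mul_smul_comm, mul_eq_zero_of_xi hk hst _ hz' (A.xi_part s hy), smul_zero]
        all_goals rw [← left (l + j) (by omega) _ hxz, right i hi.pos _ y (A.part_le _ _ hy)]
  · refine A.grading_induction (p := fun z => A.xi (x * y) * z = A.xi x * z * y)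
      (fun t z hz => h.xi_zero_pos x hx y hy j t hj z hz) (fun x x' hx hx' => ?_) hz
    simp only [add_mul, mul_add, hx, hx']
  · refine A.grading_induction
      (p := fun y => (A.xi ^ (j * (i + 1))) (x * y) * z = A.xi x * (A.xi ^ (j + 1)) z * y)
      (fun s y hy => ?_) (fun x x' hx hx' => ?_) hy
    swap
    · simp only [mul_add _ x x', map_add, add_mul, hx, hx']
    refine A.grading_induction
      (p := fun z => (A.xi ^ (j * (i + 1))) (x * y) * z = A.xi x * (A.xi ^ (j + 1)) z * y)
      (fun t z hz => ?_) (fun x x' hx hx' => ?_) hz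
    swap
    · simp only [mul_add _ x x', mul_add (A.xi _), map_add, add_mul, hx, hx']
    have hp := h.xi_pos_pos x hx i s j t hi hj y hy z hz
    obtain ⟨i, rfl⟩ := Nat.exists_eq_add_of_le' hi
    obtain ⟨j, rfl⟩ := Nat.exists_eq_add_of_le' hj
    -- Only parities of exponents matter, so the truncated differences `i - 1` and `j - 1` of the
    -- axiom can be replaced by the sums `i + 1` and `j + 1`.
    have h1 : A.xi ^ ((j + 1) * (i + 1 + 1)) = A.xi ^ ((j + 1) * i) :=
      A.xi_pow_congr (by grind)
    have h2 : A.xi ^ (j + 1 + 1) = A.xi ^ j := A.xi_pow_congr (by grind)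
    have h3 : (A.xi ^ ((j + 1) * i)) (x * y) = x * (A.xi ^ ((j + 1) * i)) y := by
      rcases Nat.even_or_odd ((j + 1) * i) with he | he
      · rw [A.xi_pow_of_even he]; rfl
      · rw [A.xi_pow_of_odd he, right _ hi x y (A.part_le _ _ hy)]
    rw [h1, h2, h3, A.xi_pow_part _ s hy, A.xi_pow_part _ t hz]
    simpa only [mul_smul_comm, smul_mul_assoc, Nat.add_sub_cancel] using hp

/-- Products of homogeneous elements inherit eigenvector equations, and `mem_part_of_xi` turns these
back into memberships in parts; the ideal conditions follow by linearity. -/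
theorem XiAxioms.isPGPerm (hk : ringChar k ≠ 2) (h : A.XiAxioms)
    (hfin : ∀ i, Module.Finite k (A.grading i)) : A.IsPGPerm := by
  have right : ∀ (n p i : ℕ) (t : Fin 2), 1 ≤ i → n ≤ i → ∀ a ∈ A.grading p, ∀ x ∈ A.part i t,
      a * x ∈ ⨆ i ≥ n, A.part i t := fun n p i t hi hn a ha x hx => by
    refine mem_iSup_part (i := p + i) (by omega) ?_
    refine A.mem_part_of_xi hk t (SetLike.mul_mem_graded ha (A.part_le _ _ hx)) ?_
    rw [h.xi_mul_right p i hi a ha x (A.part_le _ _ hx), A.xi_part t hx, mul_smul_comm]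
  have left : ∀ (p i : ℕ) (t : Fin 2), 2 ≤ i → ∀ a ∈ A.grading p, ∀ x ∈ A.part i t,
      x * a ∈ ⨆ i ≥ 2, A.part i t := fun p i t hi a ha x hx => by
    refine mem_iSup_part (i := i + p) (by omega) ?_
    refine A.mem_part_of_xi hk t (SetLike.mul_mem_graded (A.part_le _ _ hx) ha) ?_
    rw [h.xi_mul_left i p hi x (A.part_le _ _ hx) a ha, A.xi_part t hx, smul_mul_assoc]
  have right' : ∀ (n : ℕ) (t : Fin 2) (a : A.carrier), 1 ≤ n →
      (⨆ i ≥ n, A.part i t) ≤ (⨆ i ≥ n, A.part i t).comap (LinearMap.mulLeft k a) := by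
    intro n t a hn
    refine iSup₂_le fun i hi x hx => ?_
    rw [Submodule.mem_comap, LinearMap.mulLeft_apply]
    induction a using DirectSum.Decomposition.inductionOn A.grading with
    | zero => simp
    | add a b ha hb => rw [add_mul]; exact add_mem ha hb
    | homogeneous a => exact right n _ i t (by omega) hi a a.2 x hx
  have left' : ∀ (t : Fin 2) (a : A.carrier),
      (⨆ i ≥ 2, A.part i t) ≤ (⨆ i ≥ 2, A.part i t).comap (LinearMap.mulRight k a) := by
    intro t a
    refine iSup₂_le fun i hi x hx => ?_
    rw [Submodule.mem_comap, LinearMap.mulRight_apply]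
    induction a using DirectSum.Decomposition.inductionOn A.grading with
    | zero => simp
    | add a b ha hb => rw [mul_add]; exact add_mem ha hb
    | homogeneous a => exact left _ i t hi a a.2 x hx
  refine ⟨hfin, fun t a x hx => right' 1 t a le_rfl hx,
    fun t a x hx => ⟨right' 2 t a (by omega) hx, left' t a hx⟩,
    fun l r i s j t hl x hx y hy z hz => ?_, h.zero_zero,
    fun x hx y hy j t hj z hz => h.zero_pos j hj x hx y hy z (A.part_le _ _ hz),
    fun x hx i s j t hi hj y hy z hz => ?_⟩
  · have hx' := A.part_le _ _ hx
    have hy' := A.part_le _ _ hy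
    have hz' := A.part_le _ _ hz
    have hxz : x * z ∈ A.grading (l + j) := SetLike.mul_mem_graded hx' hz'
    rw [← mul_assoc, ← mul_assoc, h.perm l i j hl x hx' y hy' z hz']
    rcases Nat.even_or_odd (i * j) with he | he
    · rw [A.xi_pow_of_even he, permSign, if_neg, one_smul, Module.End.one_apply]
      rintro ⟨-, -, h1, h2⟩
      exact Nat.not_even_iff_odd.2 (h1.mul h2) he
    · obtain ⟨hi, hj⟩ := Nat.odd_mul.1 he
      rw [A.xi_pow_of_odd he, h.xi_mul_right _ i hi.pos _ hxz y hy']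
      have hxz' : A.xi (x * z) = (-1 : ℤ) ^ (t : ℕ) • (x * z) := by
        rw [h.xi_mul_right _ j hj.pos _ hx' z hz', A.xi_part t hz, mul_smul_comm]
      by_cases hst : t = s
      · subst hst
        rw [A.xi_part t hy, permSign]
        match t with
        | 0 => simp
        | 1 => simp [hi, hj]
      · rw [A.xi_part s hy, mul_smul_comm, mul_eq_zero_of_xi hk hst _ hxz' (A.xi_part s hy),
          smul_zero, smul_zero]
        rw [← h.xi_mul_left (l + j) _ (by omega) _ hxz y hy', h.xi_mul_right _ i hi.pos _ hxz y hy']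
  · have hp := h.pos_pos i j hi hj x hx y (A.part_le _ _ hy) z (A.part_le _ _ hz)
    obtain ⟨i, rfl⟩ := Nat.exists_eq_add_of_le' hi
    obtain ⟨j, rfl⟩ := Nat.exists_eq_add_of_le' hj
    have h1 : A.xi ^ ((j + 1) * (i + 1 + 1)) = A.xi ^ ((j + 1) * i) :=
      A.xi_pow_congr (by grind)
    have h2 : A.xi ^ (j + 1 + 1) = A.xi ^ j := A.xi_pow_congr (by grind)
    have h3 : (A.xi ^ ((j + 1) * i)) (x * y) = x * (A.xi ^ ((j + 1) * i)) y := by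
      rcases Nat.even_or_odd ((j + 1) * i) with he | he
      · rw [A.xi_pow_of_even he]; rfl
      · rw [A.xi_pow_of_odd he, h.xi_mul_right 1 _ hi x hx y (A.part_le _ _ hy)]
    rw [h1, h2, h3, A.xi_pow_part _ s hy, A.xi_pow_part _ t hz] at hp
    simpa only [mul_smul_comm, smul_mul_assoc, Nat.add_sub_cancel] using hp

end TypedGradedAlgebra

/-! ### Signs of block permutations -/

theorem blockEquiv_apply {m n r : ℕ} (h : m + n = r + 1) (i : Fin m)
    (a : Fin n ⊕ {c : Fin m // c ≠ i}) : blockEquiv h i a = blockPos h i a := rfl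

theorem sign_innerPerm {m n r : ℕ} (h : m + n = r + 1) (i : Fin m) (σ : Equiv.Perm (Fin n)) :
    Equiv.Perm.sign (innerPerm h i σ) = Equiv.Perm.sign σ := by
  rw [innerPerm, ← Equiv.trans_assoc, Equiv.Perm.sign_symm_trans_trans]
  exact (Equiv.Perm.sign_sumCongr σ 1).trans (by simp)

/-- The first input of the block at `i` is treated as the input `i`, and the other `n` inputs of the
block are the left summand. -/
def headPos {m n r : ℕ} (h : m + n = r) (i : Fin m) : Fin n ⊕ Fin m → Fin r
  | .inl a => ⟨i + 1 + a, by omega⟩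
  | .inr c => if (c : ℕ) ≤ i then ⟨c, by omega⟩ else ⟨c + n, by omega⟩

theorem headPos_bijective {m n r : ℕ} (h : m + n = r) (i : Fin m) :
    Function.Bijective (headPos h i) := by
  rw [Fintype.bijective_iff_injective_and_card]
  constructor
  · rintro (a | c) (b | d) hab <;> simp only [headPos] at hab <;>
      (try split_ifs at hab) <;> simp only [Fin.mk.injEq] at hab
    · congr 1; ext; omega
    · omega
    · omega
    · omega
    · omega
    · congr 1; ext; omega
    · omega
    · omega
    · congr 1; ext; omega
  · simp; omega

/-- `headPos` as a bijection. -/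
noncomputable def headEquiv {m n r : ℕ} (h : m + n = r) (i : Fin m) : Fin n ⊕ Fin m ≃ Fin r :=
  Equiv.ofBijective (headPos h i) (headPos_bijective h i)

theorem headEquiv_apply {m n r : ℕ} (h : m + n = r) (i : Fin m) (a : Fin n ⊕ Fin m) :
    headEquiv h i a = headPos h i a := rfl

theorem outerPerm_blockPos {m n r : ℕ} (h : m + n = r + 1) (i : Fin m)
    (φ : Equiv.Perm (Fin m)) (a : Fin n ⊕ {c : Fin m // c ≠ i}) :
    outerPerm h i φ (blockPos h i a) = blockPos h (φ i)
      (Sum.map id (fun c => ⟨φ c.1, φ.injective.ne_iff.2 c.2⟩) a) := by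
  rw [outerPerm, ← blockEquiv_apply, Equiv.trans_apply, Equiv.symm_apply_apply, Equiv.trans_apply,
    blockEquiv_apply]
  rcases a with a | a <;> rfl

/-- In block coordinates the index types `c ≠ i` and `c ≠ φ i` differ, so `outerPerm` is not visibly
a conjugate. Letting the head of the block play the role of input `i` makes the index type `Fin n ⊕
Fin m` on both sides, with `φ` acting on the second summand. -/
theorem outerPerm_headPos {m n r : ℕ} (h : m + (n + 1) = r + 1) (i : Fin m)
    (φ : Equiv.Perm (Fin m)) (a : Fin n ⊕ Fin m) :
    outerPerm h i φ (headPos (by omega) i a) = headPos (by omega) (φ i) (Sum.map id φ a) := by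
  rcases a with a | c
  · have h1 := outerPerm_blockPos h i φ (.inl a.succ)
    convert h1 using 1
    · congr 1
      ext
      simp only [headPos, blockPos, Fin.val_succ]
      omega
    · ext
      simp only [headPos, blockPos, Sum.map_inl, id, Fin.val_succ]
      omega
  · by_cases hc : c = i
    · subst hc
      have h1 := outerPerm_blockPos h c φ (.inl 0)
      convert h1 using 1
      · congr 1
        ext
        simp [headPos, blockPos]
      · ext
        simp [headPos, blockPos]
    · have h1 := outerPerm_blockPos h i φ (.inr ⟨c, hc⟩)
      have h2 : (c : ℕ) ≠ i := fun e => hc (Fin.ext e)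
      have h3 : (φ c : ℕ) ≠ φ i := fun e => hc (φ.injective (Fin.ext e))
      convert h1 using 1
      · congr 1
        ext
        simp only [headPos, blockPos]
        split_ifs <;> simp only <;> omega
      · ext
        simp only [headPos, blockPos, Sum.map_inr]
        split_ifs <;> simp only <;> omega

/-- Moving the block from position `i` to position `j`. -/
noncomputable def shiftPerm {m n r : ℕ} (h : m + n = r) (i j : Fin m) : Equiv.Perm (Fin r) :=
  (headEquiv h i).symm.trans (headEquiv h j)

theorem shiftPerm_headPos {m n r : ℕ} (h : m + n = r) (i j : Fin m) (a : Fin n ⊕ Fin m) :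
    shiftPerm h i j (headPos h i a) = headPos h j a := by
  rw [shiftPerm, ← headEquiv_apply, Equiv.trans_apply, Equiv.symm_apply_apply, headEquiv_apply]

/-- The `n` tail inputs jump over the single input `j`, which is a cycle on `n + 1` consecutive
positions. -/
theorem sign_shiftPerm_succ {m n r : ℕ} (h : m + n = r) (i j : Fin m) (hij : (j : ℕ) = i + 1) :
    Equiv.Perm.sign (shiftPerm h i j) = (-1) ^ n := by
  have h1 : (i : ℕ) + 1 + n < r := by omega
  have : NeZero r := ⟨by omega⟩
  have h2 : shiftPerm h i j = Fin.cycleIcc ⟨i + 1, by omega⟩ ⟨i + 1 + n, h1⟩ := by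
    ext p
    obtain ⟨a, rfl⟩ := (headPos_bijective h i).2 p
    rw [shiftPerm_headPos]
    rcases a with a | c
    · rw [Fin.cycleIcc_of_ge_of_lt, Fin.val_add_one_of_lt']
      · simp only [headPos]; omega
      · simp only [headPos]; omega
      · simp only [headPos, Fin.le_def]; omega
      · simp only [headPos, Fin.lt_def]; omega
    · rcases lt_trichotomy (c : ℕ) j with hc | hc | hc
      · rw [Fin.cycleIcc_of_lt]
        · simp only [headPos]
          split_ifs <;> simp only <;> omega
        · simp only [headPos, Fin.lt_def]
          split_ifs <;> simp only <;> omega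
      · have h3 : headPos h i (.inr c) = ⟨i + 1 + n, h1⟩ := by
          ext
          simp only [headPos]
          split_ifs <;> simp only <;> omega
        rw [h3, Fin.cycleIcc_of_last]
        · simp only [headPos]
          split_ifs <;> simp only <;> omega
        · simp [Fin.le_def]
      · rw [Fin.cycleIcc_of_gt]
        · simp only [headPos]
          split_ifs <;> simp only <;> omega
        · simp only [headPos, Fin.lt_def]
          split_ifs <;> simp only <;> omega
  rw [h2, Fin.sign_cycleIcc_of_le (by simp [Fin.le_def])]
  congr 1
  simp

theorem shiftPerm_trans {m n r : ℕ} (h : m + n = r) (i j l : Fin m) :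
    (shiftPerm h i j).trans (shiftPerm h j l) = shiftPerm h i l := by
  ext p
  obtain ⟨a, rfl⟩ := (headPos_bijective h i).2 p
  rw [Equiv.trans_apply, shiftPerm_headPos, shiftPerm_headPos, shiftPerm_headPos]

theorem sign_shiftPerm_zero {m n r : ℕ} (h : m + 1 + n = r) (i : Fin (m + 1)) :
    Equiv.Perm.sign (shiftPerm h 0 i) = (-1) ^ (n * (i : ℕ)) := by
  induction i using Fin.induction with
  | zero => simp [shiftPerm]
  | succ i ih =>
    rw [← shiftPerm_trans h 0 i.castSucc i.succ, Equiv.Perm.sign_trans, ih,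
      sign_shiftPerm_succ h i.castSucc i.succ (by simp), ← pow_add]
    congr 1
    simp
    ring

/-- Shifts compose, so both can be compared with the shift from `0`. Writing `i + j` for the
distance is harmless modulo 2. -/
theorem sign_shiftPerm {m n r : ℕ} (h : m + n = r) (i j : Fin m) :
    Equiv.Perm.sign (shiftPerm h i j) = (-1) ^ (n * (i + j : ℕ)) := by
  obtain _ | m := m
  · exact i.elim0
  have h1 := congrArg Equiv.Perm.sign (shiftPerm_trans h 0 i j)
  rw [Equiv.Perm.sign_trans, sign_shiftPerm_zero, sign_shiftPerm_zero] at h1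
  rw [eq_comm, ← mul_right_inj ((-1 : ℤˣ) ^ (n * (i : ℕ))), mul_comm _ (Equiv.Perm.sign _), h1,
    ← pow_add, mul_add, ← add_assoc, pow_add, ← two_mul, pow_mul, Int.units_sq, one_pow,
    one_mul]

/-- First `φ` permutes the heads while the tail stays after `i`, which is a conjugate of `1 ⊕ φ`;
then the tail of length `n` is shifted to its place after `φ i`. The two factors of the sign come
from these two steps. -/
theorem sign_outerPerm {m n r : ℕ} (h : m + (n + 1) = r + 1) (i : Fin m)
    (φ : Equiv.Perm (Fin m)) :
    Equiv.Perm.sign (outerPerm h i φ) =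
      Equiv.Perm.sign φ * (-1) ^ (n * (i + φ i : ℕ)) := by
  have h' : m + n = r := by omega
  have h1 : outerPerm h i φ = ((headEquiv h' i).symm.trans
      ((Equiv.sumCongr (Equiv.refl (Fin n)) φ).trans (headEquiv h' i))).trans
        (shiftPerm h' i (φ i)) := by
    ext p
    obtain ⟨a, rfl⟩ := (headPos_bijective h' i).2 p
    rw [outerPerm_headPos, ← headEquiv_apply h' i a]
    simp only [Equiv.trans_apply, Equiv.symm_apply_apply]
    rw [headEquiv_apply, shiftPerm_headPos]
    rcases a with a | a <;> rfl
  rw [h1, Equiv.Perm.sign_trans, ← Equiv.trans_assoc, Equiv.Perm.sign_symm_trans_trans,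
    sign_shiftPerm, mul_comm]
  congr 1
  exact (Equiv.Perm.sign_sumCongr 1 φ).trans (by simp)

/-! ### The operad of a pseudo-graded-Perm algebra -/

namespace TypedGradedAlgebra

variable {k : Type u} [Field k] {A : TypedGradedAlgebra.{v, u} k}

theorem XiAxioms.mul_xi_pow (h : A.XiAxioms) (e : ℕ) {p i : ℕ} (hi : 1 ≤ i) {a x : A.carrier}
    (ha : a ∈ A.grading p) (hx : x ∈ A.grading i) :
    a * (A.xi ^ e) x = (A.xi ^ e) (a * x) := by
  rcases Nat.even_or_odd e with he | he
  · rw [A.xi_pow_of_even he]; rfl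
  · rw [A.xi_pow_of_odd he, h.xi_mul_right p i hi a ha x hx]

theorem XiAxioms.xi_pow_mul (h : A.XiAxioms) (e : ℕ) {p i : ℕ} (hi : 2 ≤ i) {x a : A.carrier}
    (hx : x ∈ A.grading i) (ha : a ∈ A.grading p) :
    (A.xi ^ e) x * a = (A.xi ^ e) (x * a) := by
  rcases Nat.even_or_odd e with he | he
  · rw [A.xi_pow_of_even he]; rfl
  · rw [A.xi_pow_of_odd he, h.xi_mul_left i p hi x hx a ha]

theorem compFun_of_eq_zero {m n : ℕ} {i : Fin m} (hi : (i : ℕ) = 0) (x y : A.carrier) :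
    A.compFun m n i x y = x * y := by
  unfold compFun
  simp [hi]

theorem compFun_two_one {i : Fin 2} (hi : (i : ℕ) = 1) (x y : A.carrier) :
    A.compFun 2 1 i x y = A.xi (A.xi x * y) := by
  simp [compFun, hi]

theorem compFun_two {n : ℕ} {i : Fin 2} (hi : (i : ℕ) = 1) (x y : A.carrier) :
    A.compFun 2 (n + 2) i x y = A.xi x * (A.xi ^ n) y := by
  have h : A.xi ^ (n + 2) = A.xi ^ n := A.xi_pow_congr (by grind)
  simp [compFun, hi, h]

theorem compFun_three {m n : ℕ} (i : Fin (m + 3)) (x y : A.carrier) :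
    A.compFun (m + 3) (n + 1) i x y = (A.xi ^ (n * (i : ℕ))) x * y := by
  simp [compFun]

theorem compFun_zero_right {m n : ℕ} (i : Fin m) (x : A.carrier) :
    A.compFun m n i x 0 = 0 := by
  simp [compFun]

theorem compFun_zero_left {m n : ℕ} (i : Fin m) (y : A.carrier) :
    A.compFun m n i 0 y = 0 := by
  simp [compFun]

theorem eq_zero_of_mem_arity_zero {x : A.carrier} (hx : x ∈ A.arity 0) : x = 0 := hx

/-- Composition with an operation of arity at least three on the outside. -/
theorem XiAxioms.compFun_eq (h : A.XiAxioms) {m n : ℕ} {i : Fin (m + 1)} (hi : 2 ≤ m)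
    {x y : A.carrier} (hx : x ∈ A.grading m) (hy : y ∈ A.grading n) :
    A.compFun (m + 1) (n + 1) i x y = (A.xi ^ (n * (i : ℕ))) (x * y) := by
  obtain ⟨m, rfl⟩ := Nat.exists_eq_add_of_le' hi
  rw [compFun_three, h.xi_pow_mul _ hi hx hy]

/-- Composition at the second input of a binary operation, when the inner operation has arity at
least two. -/
theorem XiAxioms.compFun_two_eq (h : A.XiAxioms) {n : ℕ} {i : Fin 2} (hi : (i : ℕ) = 1)
    (hn : 1 ≤ n) {x y : A.carrier} (hx : x ∈ A.grading 1) (hy : y ∈ A.grading n) :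
    A.compFun 2 (n + 1) i x y = (A.xi ^ (n + 1)) (A.xi x * y) := by
  obtain ⟨n, rfl⟩ := Nat.exists_eq_add_of_le' hn
  rw [compFun_two hi, h.mul_xi_pow _ hn (A.xi_mem hx) hy,
    A.xi_pow_congr (a := n) (b := n + 1 + 1) (by grind)]

/-- Multiplying on the left by positive degree erases the exceptional formulas for binary `y`: at
the exceptional input `x * y` already has degree at least 2, so `xi` can be pulled out of the whole
product. This is what makes sequential composition a matter of comparing exponents. -/
theorem XiAxioms.mul_compFun (h : A.XiAxioms) {l m n : ℕ} (hl : 1 ≤ l) (j : Fin (m + 1))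
    {x y z : A.carrier} (hx : x ∈ A.grading l) (hy : y ∈ A.grading m) (hz : z ∈ A.grading n) :
    x * A.compFun (m + 1) (n + 1) j y z = (A.xi ^ (n * (j : ℕ))) (x * y * z) := by
  have hxy : x * y ∈ A.grading (l + m) := SetLike.mul_mem_graded hx hy
  have hyz : y * z ∈ A.grading (m + n) := SetLike.mul_mem_graded hy hz
  by_cases hj : (j : ℕ) = 0
  · rw [compFun_of_eq_zero hj, hj, mul_zero, pow_zero, Module.End.one_apply, mul_assoc]
  by_cases hm : 2 ≤ m
  · rw [h.compFun_eq hm hy hz, h.mul_xi_pow _ (by omega) hx hyz, mul_assoc]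
  obtain rfl : m = 1 := by omega
  have hj : (j : ℕ) = 1 := by omega
  have hyz' : A.xi y * z ∈ A.grading (1 + n) := SetLike.mul_mem_graded (A.xi_mem hy) hz
  have h1 : x * (A.xi y * z) = A.xi (x * y * z) := by
    rw [← mul_assoc, ← h.xi_mul_right l 1 le_rfl x hx y hy,
      ← h.xi_mul_left (l + 1) n (by omega) _ hxy z hz]
  obtain _ | n := n
  · rw [compFun_two_one hj, ← h.xi_mul_right l _ le_rfl x hx _ hyz', h1, xi_xi, zero_mul,
      pow_zero, Module.End.one_apply]
  · rw [h.compFun_two_eq hj (by omega) hy hz, h.mul_xi_pow _ (by omega) hx hyz', h1, xi_eq_pow,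
      xi_pow_xi_pow, hj]
    exact A.xi_pow_apply_congr (by grind) rfl

theorem XiAxioms.compFun_seq (h : A.XiAxioms) {l m n r q : ℕ} (h₁ : l + m = r + 1)
    (h₃ : m + n = q + 1) (i : Fin l) (j : Fin m) (p : Fin r) (hp : (p : ℕ) = i + j)
    {x y z : A.carrier} (hx : x ∈ A.arity l) (hy : y ∈ A.arity m) (hz : z ∈ A.arity n) :
    A.compFun r n p (A.compFun l m i x y) z = A.compFun l q i x (A.compFun m n j y z) := by
  obtain _ | l := l
  · exact i.elim0
  obtain _ | m := m
  · exact j.elim0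
  obtain _ | n := n
  · rw [eq_zero_of_mem_arity_zero hz]
    simp only [compFun_zero_right]
  obtain rfl : r = l + m + 1 := by omega
  obtain rfl : q = m + n + 1 := by omega
  simp only [arity] at hx hy hz
  have hxy : x * y ∈ A.grading (l + m) := SetLike.mul_mem_graded hx hy
  have hcomp : A.compFun (m + 1) (n + 1) j y z ∈ A.grading (m + n) :=
    A.compFun_mem (r := m + n + 1) (by omega) j hy hz
  by_cases hi : (i : ℕ) = 0
  · rw [compFun_of_eq_zero hi, compFun_of_eq_zero hi]
    by_cases hl : 1 ≤ l
    · rw [h.mul_compFun hl j hx hy hz]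
      by_cases hlm : 2 ≤ l + m
      · rw [h.compFun_eq hlm hxy hz, hp, hi, zero_add]
      · have hj : (j : ℕ) = 0 := by omega
        rw [compFun_of_eq_zero (by omega), hj, mul_zero, pow_zero, Module.End.one_apply]
    -- For unary `x` multiplication does not raise the degree, so the exceptional formulas for
    -- binary `y` must be matched with those for the binary `x * y`.
    obtain rfl : l = 0 := by omega
    by_cases hj : (j : ℕ) = 0
    · rw [compFun_of_eq_zero (by omega), compFun_of_eq_zero hj, mul_assoc]
    by_cases hm : 2 ≤ m
    · rw [h.compFun_eq hm hy hz, h.compFun_eq (by omega) hxy hz,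
        h.mul_xi_pow _ (by omega) hx (SetLike.mul_mem_graded hy hz), mul_assoc, hp, hi, zero_add]
    obtain rfl : m = 1 := by omega
    have hj : (j : ℕ) = 1 := by omega
    have hyz : A.xi y * z ∈ A.grading (1 + n) := SetLike.mul_mem_graded (A.xi_mem hy) hz
    have h1 : x * (A.xi y * z) = A.xi (x * y) * z := by
      rw [← mul_assoc, ← h.xi_mul_right 0 1 le_rfl x hx y hy]
    obtain _ | n := n
    · rw [compFun_two_one (by omega), compFun_two_one hj,
        ← h.xi_mul_right 0 _ le_rfl x hx _ hyz, h1]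
    · rw [h.compFun_two_eq (by omega) (by omega) hxy hz, h.compFun_two_eq hj (by omega) hy hz,
        h.mul_xi_pow _ (by omega) hx hyz, h1]
  by_cases hl : 2 ≤ l
  · rw [h.compFun_eq hl hx hy, h.compFun_eq (by omega) (A.xi_pow_mem hxy _) hz,
      h.xi_pow_mul _ (by omega) hxy hz, xi_pow_xi_pow, h.compFun_eq hl hx hcomp,
      h.mul_compFun (by omega) j hx hy hz, xi_pow_xi_pow, hp]
    exact A.xi_pow_apply_congr (by grind) rfl
  obtain rfl : l = 1 := by omega
  have hi : (i : ℕ) = 1 := by omega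
  have hx' := A.xi_mem hx
  have hxy' : A.xi x * y ∈ A.grading (1 + m) := SetLike.mul_mem_graded hx' hy
  obtain _ | m := m
  -- Substituting unary `y` in the second input leaves a binary operation, and the outer `xi` of the
  -- first formula cancels the inner `xi` of the next.
  · have hj : (j : ℕ) = 0 := by omega
    rw [compFun_two_one hi, compFun_of_eq_zero hj]
    obtain _ | n := n
    · rw [compFun_two_one (by omega), compFun_two_one hi, xi_xi, mul_assoc]
    · have hyz : y * z ∈ A.grading (n + 1) := by
        simpa using SetLike.mul_mem_graded hy hz
      rw [compFun_two (by omega), xi_xi, h.mul_xi_pow _ (by omega) hxy' hz, mul_assoc,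
        ← h.mul_xi_pow _ (by omega) hx' hyz]
      simp only [zero_add]
      rw [compFun_two hi]
  · rw [h.compFun_two_eq hi (by omega) hx hy,
      h.compFun_eq (by omega) (A.xi_pow_mem hxy' _) hz, h.xi_pow_mul _ (by omega) hxy' hz,
      xi_pow_xi_pow, h.compFun_two_eq hi (by omega) hx hcomp,
      h.mul_compFun le_rfl j hx' hy hz, xi_pow_xi_pow, hp, hi]
    exact A.xi_pow_apply_congr (by grind) rfl

/-- Each axiom on exchanging the last two factors is one case: `perm` when `x` has arity at least 3,
and for binary `x` one of `zero_zero`, `zero_pos`, `pos_pos`, according to which of `y` and `z` are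
unary. -/
theorem XiAxioms.compFun_par (h : A.XiAxioms) {l m n r q : ℕ} (h₁ : l + m = r + 1)
    (h₃ : l + n = q + 1) (i j : Fin l) (p : Fin r) (p' : Fin q) (hij : i < j)
    (hp : (p : ℕ) + 1 = j + m) (hp' : (p' : ℕ) = i)
    {x y z : A.carrier} (hx : x ∈ A.arity l) (hy : y ∈ A.arity m) (hz : z ∈ A.arity n) :
    A.compFun r n p (A.compFun l m i x y) z = A.compFun q m p' (A.compFun l n j x z) y := by
  obtain _ | l := l
  · exact i.elim0
  obtain _ | m := m
  · rw [eq_zero_of_mem_arity_zero hy]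
    simp only [compFun_zero_right, compFun_zero_left]
  obtain _ | n := n
  · rw [eq_zero_of_mem_arity_zero hz]
    simp only [compFun_zero_right, compFun_zero_left]
  obtain rfl : r = l + m + 1 := by omega
  obtain rfl : q = l + n + 1 := by omega
  simp only [arity] at hx hy hz
  have hxy : x * y ∈ A.grading (l + m) := SetLike.mul_mem_graded hx hy
  have hxz : x * z ∈ A.grading (l + n) := SetLike.mul_mem_graded hx hz
  have hij' : (i : ℕ) < j := hij
  by_cases hl : 2 ≤ l
  · rw [h.compFun_eq hl hx hy, h.compFun_eq (by omega) (A.xi_pow_mem hxy _) hz,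
      h.xi_pow_mul _ (by omega) hxy hz, xi_pow_xi_pow, h.compFun_eq hl hx hz,
      h.compFun_eq (by omega) (A.xi_pow_mem hxz _) hy, h.xi_pow_mul _ (by omega) hxz hy,
      xi_pow_xi_pow, h.perm l m n hl x hx y hy z hz, xi_pow_xi_pow, hp',
      show (p : ℕ) = j + m by omega]
    exact A.xi_pow_apply_congr (by grind) rfl
  obtain rfl : l = 1 := by omega
  have hi : (i : ℕ) = 0 := by omega
  have hj : (j : ℕ) = 1 := by omega
  have hx' := A.xi_mem hx
  rw [compFun_of_eq_zero hi, compFun_of_eq_zero (hp'.trans hi)]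
  obtain _ | m := m
  · obtain _ | n := n
    · rw [compFun_two_one (by omega), compFun_two_one hj, h.zero_zero x hx y hy z hz]
    · rw [compFun_two (by omega), compFun_two hj,
        h.zero_pos (n + 1) (by omega) x hx y hy _ (A.xi_pow_mem hz _)]
  · rw [h.compFun_eq (by omega) hxy hz]
    obtain _ | n := n
    -- Here the second inner operation is the unary one: the same axiom is applied to `A.xi x`, with
    -- `y` and `z` exchanged.
    · rw [compFun_two_one hj, h.zero_pos (m + 1) (by omega) _ hx' z hz y hy, xi_xi, zero_mul,
        pow_zero, Module.End.one_apply]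
    · rw [compFun_two hj, ← h.xi_pow_mul _ (by omega) hxy hz]
      have h1 := h.pos_pos (m + 1) (n + 1) (by omega) (by omega) x hx y hy z hz
      rw [A.xi_pow_congr (a := n + 1 + 1) (b := n) (by grind)] at h1
      rw [← h1, A.xi_pow_congr (a := (n + 1) * p) (b := (n + 1) * (m + 1 + 1))]
      rw [show (p : ℕ) = m + 1 + 1 by omega]
      grind

theorem actFun_eq_pow {n : ℕ} (σ : Equiv.Perm (Fin n)) {e : ℕ}
    (he : Equiv.Perm.sign σ = (-1) ^ e) : A.actFun σ = A.xi ^ e := by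
  unfold actFun
  rcases Nat.even_or_odd e with h | h
  · rw [he, h.neg_one_pow, if_pos rfl, A.xi_pow_of_even h]; rfl
  · rw [he, h.neg_one_pow, if_neg (by decide), A.xi_pow_of_odd h]

theorem exists_sign_eq_pow {n : ℕ} (σ : Equiv.Perm (Fin n)) :
    ∃ e : ℕ, Equiv.Perm.sign σ = (-1) ^ e := by
  rcases Int.units_eq_one_or (Equiv.Perm.sign σ) with h | h
  · exact ⟨0, by simpa using h⟩
  · exact ⟨1, by simpa using h⟩

theorem XiAxioms.compFun_xi_pow (h : A.XiAxioms) {m n : ℕ} (hn : 1 ≤ n) (i : Fin m) (e : ℕ)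
    {x y : A.carrier} (hx : x ∈ A.arity m) (hy : y ∈ A.grading n) :
    A.compFun m (n + 1) i x ((A.xi ^ e) y) = (A.xi ^ e) (A.compFun m (n + 1) i x y) := by
  obtain _ | m := m
  · exact i.elim0
  by_cases hi : (i : ℕ) = 0
  · rw [compFun_of_eq_zero hi, compFun_of_eq_zero hi, h.mul_xi_pow _ hn hx hy]
  by_cases hm : 2 ≤ m
  · rw [h.compFun_eq hm hx hy, h.compFun_eq hm hx (A.xi_pow_mem hy _), h.mul_xi_pow _ hn hx hy,
      xi_pow_xi_pow, xi_pow_xi_pow, add_comm]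
  obtain rfl : m = 1 := by omega
  rw [h.compFun_two_eq (by omega) hn hx hy, h.compFun_two_eq (by omega) hn hx (A.xi_pow_mem hy _),
    h.mul_xi_pow _ hn (A.xi_mem hx) hy, xi_pow_xi_pow, xi_pow_xi_pow, add_comm]

theorem XiAxioms.compFun_act (h : A.XiAxioms) {m n r : ℕ} (h₁ : m + n = r + 1) (i : Fin m)
    (σ : Equiv.Perm (Fin n)) {x y : A.carrier} (hx : x ∈ A.arity m) (hy : y ∈ A.arity n) :
    A.compFun m n i x (A.actFun σ y) = A.actFun (innerPerm h₁ i σ) (A.compFun m n i x y) := by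
  obtain _ | n := n
  · rw [eq_zero_of_mem_arity_zero hy]
    simp only [map_zero, compFun_zero_right]
  obtain _ | n := n
  -- `xi` need not commute with left multiplication on degree 0, but a unary operation admits only
  -- the identity permutation.
  · have h1 : Equiv.Perm.sign σ = (-1) ^ 0 := by
      rw [Subsingleton.elim (α := Equiv.Perm (Fin 1)) σ 1]
      simp
    rw [actFun_eq_pow σ h1, actFun_eq_pow _ ((sign_innerPerm h₁ i σ).trans h1)]
    rfl
  obtain ⟨e, he⟩ := exists_sign_eq_pow σ
  rw [actFun_eq_pow σ he, actFun_eq_pow _ ((sign_innerPerm h₁ i σ).trans he),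
    h.compFun_xi_pow (by omega) i e hx hy]

theorem XiAxioms.act_compFun (h : A.XiAxioms) {m n r : ℕ} (h₁ : m + n = r + 1) (i : Fin m)
    (φ : Equiv.Perm (Fin m)) {x y : A.carrier} (hx : x ∈ A.arity m) (hy : y ∈ A.arity n) :
    A.compFun m n i (A.actFun φ x) y = A.actFun (outerPerm h₁ i φ) (A.compFun m n (φ i) x y) := by
  obtain _ | n := n
  · rw [eq_zero_of_mem_arity_zero hy]
    simp only [compFun_zero_right, map_zero]
  obtain _ | m := m
  · exact i.elim0
  obtain ⟨e, he⟩ := exists_sign_eq_pow φ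
  have he' : Equiv.Perm.sign (outerPerm h₁ i φ) = (-1) ^ (e + n * (i + φ i : ℕ)) := by
    rw [sign_outerPerm, he, pow_add]
  simp only [arity] at hx hy
  have hxy : x * y ∈ A.grading (m + n) := SetLike.mul_mem_graded hx hy
  by_cases hm : 2 ≤ m
  · rw [actFun_eq_pow _ he, actFun_eq_pow _ he', h.compFun_eq hm (A.xi_pow_mem hx _) hy,
      h.compFun_eq hm hx hy, h.xi_pow_mul _ hm hx hy, xi_pow_xi_pow, xi_pow_xi_pow]
    exact A.xi_pow_apply_congr (by grind) rfl
  obtain _ | m := m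
  · have h2 : φ = 1 := Subsingleton.elim (α := Equiv.Perm (Fin 1)) _ _
    subst h2
    have h3 : Equiv.Perm.sign (outerPerm h₁ i 1) = (-1) ^ 0 := by
      rw [sign_outerPerm, Fin.fin_one_eq_zero i]
      simp
    rw [actFun_eq_pow 1 (e := 0) (by simp), actFun_eq_pow _ h3]
    rfl
  obtain rfl : m = 0 := by omega
  have hx' := A.xi_mem hx
  have hxy' : A.xi x * y ∈ A.grading (1 + n) := SetLike.mul_mem_graded hx' hy
  have hcases : φ = 1 ∨ φ = Equiv.swap 0 1 :=
    (by decide : ∀ φ : Equiv.Perm (Fin 2), φ = 1 ∨ φ = Equiv.swap 0 1) φ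
  have hsign : Equiv.Perm.sign (Equiv.swap (0 : Fin 2) 1) = (-1) ^ 1 := by decide
  rcases hcases with rfl | rfl
  · have h3 : Equiv.Perm.sign (outerPerm h₁ i 1) = (-1) ^ (2 * (n * (i : ℕ))) := by
      rw [sign_outerPerm]
      simp only [Equiv.Perm.sign_one, Equiv.Perm.one_apply, one_mul]
      congr 1
      ring
    rw [actFun_eq_pow 1 (e := 0) (by simp), actFun_eq_pow _ h3, A.xi_pow_of_even (even_two_mul _)]
    rfl
  -- The swap contributes one sign, and the two input positions add up to 1, so the tail of the
  -- block contributes `n` more. The formulas for the second input of a binary operation compensate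
  -- exactly this sign.
  have h3 : Equiv.Perm.sign (outerPerm h₁ i (Equiv.swap 0 1)) = (-1) ^ (n + 1) := by
    have h4 : (i : ℕ) + (Equiv.swap (0 : Fin 2) 1 i : ℕ) = 1 :=
      (by decide : ∀ i : Fin 2, (i : ℕ) + (Equiv.swap (0 : Fin 2) 1 i : ℕ) = 1) i
    rw [sign_outerPerm, hsign, ← pow_add, h4, mul_one, add_comm]
  rw [actFun_eq_pow _ hsign, actFun_eq_pow _ h3, pow_one]
  have hi : i = 0 ∨ i = 1 := (by decide : ∀ i : Fin 2, i = 0 ∨ i = 1) i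
  rcases hi with rfl | rfl
  · rw [Equiv.swap_apply_left, compFun_of_eq_zero rfl]
    obtain _ | n := n
    · rw [compFun_two_one rfl, zero_add, pow_one, xi_xi]
    · rw [h.compFun_two_eq rfl (by omega) hx hy, xi_pow_xi_pow, A.xi_pow_of_even (by grind)]
      rfl
  · rw [Equiv.swap_apply_right, compFun_of_eq_zero (i := 0) rfl]
    obtain _ | n := n
    · rw [compFun_two_one rfl, zero_add, pow_one, xi_xi]
    · rw [h.compFun_two_eq rfl (by omega) hx' hy, xi_xi]

theorem IsPGPerm.isATrivOperad (hk : ringChar k ≠ 2) (hA : A.IsPGPerm) :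
    A.toPreOperad.IsATrivOperad := by
  have h := hA.xiAxioms hk
  refine { act_one := fun x => Subtype.ext ?_, act_mul := fun σ τ x => Subtype.ext ?_,
           comp_one := fun i x => Subtype.ext ?_, one_comp := fun {n} x => Subtype.ext ?_,
           comp_seq := fun h₁ h₂ h₃ h₄ i j p hp x y z =>
             Subtype.ext (h.compFun_seq h₁ h₃ i j p hp x.2 y.2 z.2),
           comp_par := fun h₁ h₂ h₃ h₄ i j p p' hij hp hp' x y z =>
             Subtype.ext (h.compFun_par h₁ h₃ i j p p' hij hp hp' x.2 y.2 z.2),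
           comp_act := fun h₁ i σ x y => Subtype.ext (h.compFun_act h₁ i σ x.2 y.2),
           act_comp := fun h₁ i φ x y => Subtype.ext (h.act_compFun h₁ i φ x.2 y.2),
           reduced := fun x => Subtype.ext x.2, locallyFinite := fun n => ?_,
           aTriv := fun σ hσ x => Subtype.ext ?_ }
  · change A.actFun 1 x.1 = x.1
    rw [actFun_eq_pow 1 (e := 0) (by simp)]
    rfl
  · change A.actFun (σ * τ) x.1 = A.actFun τ (A.actFun σ x.1)
    obtain ⟨a, ha⟩ := exists_sign_eq_pow σ
    obtain ⟨b, hb⟩ := exists_sign_eq_pow τ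
    rw [actFun_eq_pow σ ha, actFun_eq_pow τ hb, xi_pow_xi_pow,
      actFun_eq_pow (σ * τ) (e := b + a) (by rw [Equiv.Perm.sign_mul, ha, hb, pow_add, mul_comm])]
  · change A.compFun _ 1 i x.1 1 = x.1
    unfold compFun
    rw [if_pos (rfl : 1 = 1)]
    split_ifs <;> simp [xi_xi]
  · change A.compFun 1 n 0 1 x.1 = x.1
    rw [compFun_of_eq_zero rfl, one_mul]
  · obtain _ | n := n
    · exact inferInstanceAs (Module.Finite k (⊥ : Submodule k A.carrier))
    · exact hA.locallyFinite n
  · change A.actFun σ x.1 = x.1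
    rw [actFun_eq_pow σ (e := 0) (by simpa using Equiv.Perm.mem_alternatingGroup.1 hσ)]
    rfl

end TypedGradedAlgebra

/-! ### The pseudo-graded-Perm algebra of an operad -/

namespace ATrivOperad

variable {k : Type u} [Field k] (P : ATrivOperad.{v, u} k) (hk : ringChar k ≠ 2)

/-- An `n`-ary operation as a homogeneous element of degree `n - 1` of `⨁ P(i+1)`. -/
noncomputable def ofOp : ∀ n : ℕ, P.obj.obj n →ₗ[k] (P.toTypedGradedAlgebra hk).carrier
  | 0 => 0
  | n + 1 => DirectSum.lof k ℕ P.piece n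

theorem ofOp_mem (n : ℕ) (x : P.obj.obj n) :
    P.ofOp hk n x ∈ (P.toTypedGradedAlgebra hk).arity n := by
  obtain _ | n := n
  · exact zero_mem _
  · exact ⟨x, rfl⟩

theorem exists_ofOp_eq {i : ℕ} {x : (P.toTypedGradedAlgebra hk).carrier}
    (hx : x ∈ (P.toTypedGradedAlgebra hk).grading i) : ∃ y, P.ofOp hk (i + 1) y = x := hx

theorem ofOp_injective (n : ℕ) : Function.Injective (P.ofOp hk n) := by
  obtain _ | n := n
  · intro x y _
    rw [P.property.reduced x, P.property.reduced y]
  · exact DirectSum.of_injective n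

theorem ofOp_one : P.ofOp hk 1 P.obj.one = 1 := rfl

theorem ofOp_congr {r r' : ℕ} {x : P.obj.obj r} {y : P.obj.obj r'}
    (h : (⟨r, x⟩ : Σ n, P.obj.obj n) = ⟨r', y⟩) : P.ofOp hk r x = P.ofOp hk r' y := by
  cases h
  rfl

theorem ofOp_comp_zero {m n r : ℕ} (h : m + 1 + n = r + 1) (x : P.obj.obj (m + 1))
    (y : P.obj.obj n) :
    P.ofOp hk r (P.obj.comp h 0 x y) = P.ofOp hk (m + 1) x * P.ofOp hk n y := by
  obtain _ | n := n
  · rw [P.property.reduced y, map_zero, map_zero, map_zero, mul_zero]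
  · have h1 : P.ofOp hk r (P.obj.comp h 0 x y) =
        P.ofOp hk (m + n + 1) (P.obj.comp (mul_arity m n) 0 x y) :=
      P.ofOp_congr hk (comp_heq P.obj _ _ 0 x y)
    rw [h1]
    exact (DirectSum.of_mul_of (A := P.piece) x y).symm

theorem sign_eq_one_of_arity_one {n : ℕ} (hn : n ≤ 1) (σ : Equiv.Perm (Fin n)) :
    Equiv.Perm.sign σ = 1 := by
  have : Subsingleton (Fin n) := Fin.subsingleton_iff_le_one.2 hn
  rw [Subsingleton.elim σ 1, Equiv.Perm.sign_one]

theorem ofOp_trivPart {i : ℕ} {x : P.obj.obj (i + 1)} (hx : x ∈ P.obj.trivPart (i + 1)) :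
    P.ofOp hk (i + 1) x ∈ (P.toTypedGradedAlgebra hk).part i 0 :=
  ⟨x, hx, rfl⟩

theorem ofOp_signPart {i : ℕ} {x : P.obj.obj (i + 2)} (hx : x ∈ P.obj.signPart (i + 2)) :
    P.ofOp hk (i + 2) x ∈ (P.toTypedGradedAlgebra hk).part (i + 1) 1 :=
  ⟨x, hx, rfl⟩

/-- Odd permutations exist only from arity 2 on, where every operation is a sum of an invariant one
and a sign one. -/
theorem ofOp_act {n : ℕ} (σ : Equiv.Perm (Fin n)) (x : P.obj.obj n) :
    P.ofOp hk n (P.obj.act σ x) = (P.toTypedGradedAlgebra hk).actFun σ (P.ofOp hk n x) := by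
  rcases Int.units_eq_one_or (Equiv.Perm.sign σ) with hσ | hσ
  · rw [P.act_even σ hσ, TypedGradedAlgebra.actFun_eq_pow σ (e := 0) (by simpa using hσ)]
    rfl
  · obtain _ | _ | n := n
    · rw [sign_eq_one_of_arity_one (by omega)] at hσ
      exact absurd hσ (by decide)
    · rw [sign_eq_one_of_arity_one (by omega)] at hσ
      exact absurd hσ (by decide)
    · rw [TypedGradedAlgebra.actFun_eq_pow σ (e := 1) (by simpa using hσ), pow_one]
      have hx : x ∈ P.obj.trivPart (n + 2) ⊔ P.obj.signPart (n + 2) := by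
        rw [P.triv_sup_sign hk n]; trivial
      obtain ⟨y, hy, z, hz, rfl⟩ := Submodule.mem_sup.1 hx
      rw [map_add, map_add, map_add, map_add, TypedGradedAlgebra.xi_even _ (P.ofOp_trivPart hk hy),
        TypedGradedAlgebra.xi_odd _ (P.ofOp_signPart hk hz), PreOperad.mem_trivPart.1 hy,
        PreOperad.mem_signPart.1 hz, hσ]
      simp

/-- The odd permutation may be chosen freely, so it can be the one that an equivariance axiom
produces. -/
theorem xi_ofOp {n : ℕ} (σ : Equiv.Perm (Fin n)) (hσ : Equiv.Perm.sign σ = -1)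
    (x : P.obj.obj n) :
    (P.toTypedGradedAlgebra hk).xi (P.ofOp hk n x) = P.ofOp hk n (P.obj.act σ x) := by
  rw [ofOp_act, TypedGradedAlgebra.actFun_eq_pow σ (e := 1) (by simpa using hσ), pow_one]

theorem xi_mul_right (p i : ℕ) (hi : 1 ≤ i) {a x : (P.toTypedGradedAlgebra hk).carrier}
    (ha : a ∈ (P.toTypedGradedAlgebra hk).grading p)
    (hx : x ∈ (P.toTypedGradedAlgebra hk).grading i) :
    (P.toTypedGradedAlgebra hk).xi (a * x) = a * (P.toTypedGradedAlgebra hk).xi x := by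
  obtain ⟨a, rfl⟩ := P.exists_ofOp_eq hk ha
  obtain ⟨x, rfl⟩ := P.exists_ofOp_eq hk hx
  obtain ⟨i, rfl⟩ := Nat.exists_eq_add_of_le' hi
  have hτ : Equiv.Perm.sign (Equiv.swap (0 : Fin (i + 1 + 1)) 1) = -1 :=
    Equiv.Perm.sign_swap (by simp)
  have h := mul_arity p (i + 1)
  rw [← P.ofOp_comp_zero hk h, P.xi_ofOp hk _ hτ,
    P.xi_ofOp hk (innerPerm h 0 _) ((sign_innerPerm _ _ _).trans hτ), ← P.ofOp_comp_zero hk h,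
    P.property.comp_act]

/-- From arity 3 on, exchanging the second and third inputs is an odd permutation that leaves the
block at the first input in place, so its block permutation is odd too. In arity 2 the only odd
permutation moves the block. -/
theorem xi_mul_left (i p : ℕ) (hi : 2 ≤ i) {a x : (P.toTypedGradedAlgebra hk).carrier}
    (ha : a ∈ (P.toTypedGradedAlgebra hk).grading p)
    (hx : x ∈ (P.toTypedGradedAlgebra hk).grading i) :
    (P.toTypedGradedAlgebra hk).xi (x * a) = (P.toTypedGradedAlgebra hk).xi x * a := by
  obtain ⟨a, rfl⟩ := P.exists_ofOp_eq hk ha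
  obtain ⟨x, rfl⟩ := P.exists_ofOp_eq hk hx
  obtain ⟨i, rfl⟩ := Nat.exists_eq_add_of_le' hi
  obtain ⟨φ, hφ, h0⟩ : ∃ φ : Equiv.Perm (Fin (i + 2 + 1)), Equiv.Perm.sign φ = -1 ∧ φ 0 = 0 :=
    ⟨Equiv.swap ⟨1, by omega⟩ ⟨2, by omega⟩, Equiv.Perm.sign_swap (by simp),
      Equiv.swap_apply_of_ne_of_ne (by simp) (by simp [Fin.ext_iff])⟩
  have h := mul_arity (i + 2) p
  have hs : Equiv.Perm.sign (outerPerm h 0 φ) = -1 := by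
    rw [sign_outerPerm, h0, hφ]
    simp
  rw [← P.ofOp_comp_zero hk h, P.xi_ofOp hk _ hφ, P.xi_ofOp hk _ hs, ← P.ofOp_comp_zero hk h,
    P.property.act_comp, h0]

theorem xi_pow_mul (e : ℕ) {i p : ℕ} (hi : 2 ≤ i) {a x : (P.toTypedGradedAlgebra hk).carrier}
    (ha : a ∈ (P.toTypedGradedAlgebra hk).grading p)
    (hx : x ∈ (P.toTypedGradedAlgebra hk).grading i) :
    ((P.toTypedGradedAlgebra hk).xi ^ e) x * a =
      ((P.toTypedGradedAlgebra hk).xi ^ e) (x * a) := by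
  rcases Nat.even_or_odd e with he | he
  · rw [TypedGradedAlgebra.xi_pow_of_even _ he]; rfl
  · rw [TypedGradedAlgebra.xi_pow_of_odd _ he, P.xi_mul_left hk i p hi ha hx]

/-- Equivariance under the transposition of `i` and `0` reduces every composition to the one at the
first input, which is the product. What remains is a power of `xi` given by the sign of the block
permutation. -/
theorem ofOp_comp {m n r : ℕ} (h : m + n = r + 1) (i : Fin m) (x : P.obj.obj m)
    (y : P.obj.obj n) :
    P.ofOp hk r (P.obj.comp h i x y) =
      (P.toTypedGradedAlgebra hk).compFun m n i (P.ofOp hk m x) (P.ofOp hk n y) := by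
  obtain _ | m := m
  · exact i.elim0
  obtain _ | n := n
  · rw [P.property.reduced y, map_zero, map_zero, map_zero, TypedGradedAlgebra.compFun_zero_right]
  obtain rfl : r = m + n + 1 := by omega
  by_cases hi : i = 0
  · subst hi
    rw [P.ofOp_comp_zero, TypedGradedAlgebra.compFun_of_eq_zero rfl]
  have hi' : (i : ℕ) ≠ 0 := fun e => hi (Fin.ext e)
  have hφ : Equiv.Perm.sign (Equiv.swap i 0) = -1 := Equiv.Perm.sign_swap hi
  have hs : Equiv.Perm.sign (outerPerm h i (Equiv.swap i 0)) = (-1) ^ (1 + n * (i : ℕ)) := by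
    rw [sign_outerPerm, hφ, Equiv.swap_apply_left, pow_add, pow_one]
    simp
  have h1 : P.obj.comp h i x y =
      P.obj.act (outerPerm h i (Equiv.swap i 0))
        (P.obj.comp h 0 (P.obj.act (Equiv.swap i 0) x) y) := by
    -- The axiom is applied to the transposed `x`, so that its left side becomes a composition with
    -- `x` itself.
    have h2 := P.property.act_comp h i (Equiv.swap i 0) (P.obj.act (Equiv.swap i 0) x) y
    rwa [P.act_odd_odd _ _ hφ hφ, Equiv.swap_apply_left] at h2
  have hx := P.ofOp_mem hk _ x
  have hy := P.ofOp_mem hk _ y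
  simp only [TypedGradedAlgebra.arity] at hx hy
  rw [h1, ofOp_act, TypedGradedAlgebra.actFun_eq_pow _ hs, P.ofOp_comp_zero, ← P.xi_ofOp hk _ hφ]
  generalize P.ofOp hk (m + 1) x = x at *
  generalize P.ofOp hk (n + 1) y = y at *
  set A := P.toTypedGradedAlgebra hk
  by_cases hm : 2 ≤ m
  · obtain ⟨m, rfl⟩ := Nat.exists_eq_add_of_le' hm
    rw [TypedGradedAlgebra.compFun_three, ← P.xi_mul_left hk _ n hm hy hx, A.xi_eq_pow,
      A.xi_pow_xi_pow, P.xi_pow_mul hk _ hm hy hx]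
    exact A.xi_pow_apply_congr (by grind) rfl
  obtain rfl : m = 1 := by omega
  have hi : (i : ℕ) = 1 := by omega
  obtain _ | n := n
  · rw [TypedGradedAlgebra.compFun_two_one hi, zero_mul, add_zero, pow_one]
  · rw [TypedGradedAlgebra.compFun_two hi, hi]
    rcases Nat.even_or_odd n with he | he
    · rw [A.xi_pow_of_even he, A.xi_pow_of_even (by grind)]
      rfl
    · rw [A.xi_pow_of_odd he, A.xi_pow_of_odd (by grind),
        P.xi_mul_right hk 1 _ (by omega) (A.xi_mem hx) hy]

theorem compFun_par {l m n r q s : ℕ} (h₁ : l + m = r + 1) (h₂ : r + n = s + 1)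
    (h₃ : l + n = q + 1) (i j : Fin l) (p : Fin r) (p' : Fin q) (hij : i < j)
    (hp : (p : ℕ) + 1 = j + m) (hp' : (p' : ℕ) = i) (x : P.obj.obj l) (y : P.obj.obj m)
    (z : P.obj.obj n) :
    (P.toTypedGradedAlgebra hk).compFun r n p ((P.toTypedGradedAlgebra hk).compFun l m i
        (P.ofOp hk l x) (P.ofOp hk m y)) (P.ofOp hk n z) =
      (P.toTypedGradedAlgebra hk).compFun q m p' ((P.toTypedGradedAlgebra hk).compFun l n j
        (P.ofOp hk l x) (P.ofOp hk n z)) (P.ofOp hk m y) := by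
  rw [← P.ofOp_comp hk h₁, ← P.ofOp_comp hk h₃, ← P.ofOp_comp hk h₂,
    ← P.ofOp_comp hk (by omega : q + m = s + 1),
    P.property.comp_par h₁ h₂ h₃ (by omega) i j p p' hij hp hp']

/-- The exchange rules are the parallel axiom at the first two inputs, rewritten through `compFun`.
-/
theorem xiAxioms : (P.toTypedGradedAlgebra hk).XiAxioms where
  xi_mul_right p i hi a ha x hx := P.xi_mul_right hk p i hi ha hx
  xi_mul_left i p hi x hx a ha := P.xi_mul_left hk i p hi ha hx
  perm l m n hl x hx y hy z hz := by
    have hxy := SetLike.mul_mem_graded hx hy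
    have hxz := SetLike.mul_mem_graded hx hz
    have hx' := hx
    have hy' := hy
    have hz' := hz
    obtain ⟨x, rfl⟩ := P.exists_ofOp_eq hk hx
    obtain ⟨y, rfl⟩ := P.exists_ofOp_eq hk hy
    obtain ⟨z, rfl⟩ := P.exists_ofOp_eq hk hz
    obtain ⟨l, rfl⟩ := Nat.exists_eq_add_of_le' hl
    have h := P.compFun_par hk (l := l + 3) (m := m + 1) (n := n + 1) (r := l + m + 3)
      (q := l + n + 3) (s := l + m + n + 3) (by omega) (by omega) (by omega) ⟨0, by omega⟩
      ⟨1, by omega⟩ ⟨m + 1, by omega⟩ ⟨0, by omega⟩ (by simp) (by simp; omega) rfl x y z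
    rw [TypedGradedAlgebra.compFun_three, TypedGradedAlgebra.compFun_of_eq_zero rfl,
      TypedGradedAlgebra.compFun_of_eq_zero rfl, TypedGradedAlgebra.compFun_three,
      P.xi_pow_mul hk _ (by omega) hz' hxy, P.xi_pow_mul hk _ hl hz' hx',
      P.xi_pow_mul hk _ (by omega) hy' hxz] at h
    -- The axiom compares `xi ^ (n * (m + 1))` on the left with `xi ^ n` on the right; clearing the
    -- left power leaves `n * (m + 1) + n`, which has the parity of `m * n`.
    have h2 := congrArg ((P.toTypedGradedAlgebra hk).xi ^ (n * (m + 1))) h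
    rw [TypedGradedAlgebra.xi_pow_xi_pow, TypedGradedAlgebra.xi_pow_xi_pow,
      TypedGradedAlgebra.xi_pow_of_even _ (Even.add_self _)] at h2
    refine h2.trans (TypedGradedAlgebra.xi_pow_apply_congr _ ?_ rfl)
    grind
  zero_zero x hx y hy z hz := by
    obtain ⟨x, rfl⟩ := P.exists_ofOp_eq hk hx
    obtain ⟨y, rfl⟩ := P.exists_ofOp_eq hk hy
    obtain ⟨z, rfl⟩ := P.exists_ofOp_eq hk hz
    have h := P.compFun_par hk (l := 2) (m := 1) (n := 1) (r := 2) (q := 2) (s := 2) rfl rfl rfl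
      0 1 1 0 (by simp) rfl rfl x y z
    rwa [TypedGradedAlgebra.compFun_two_one rfl, TypedGradedAlgebra.compFun_of_eq_zero rfl,
      TypedGradedAlgebra.compFun_of_eq_zero rfl, TypedGradedAlgebra.compFun_two_one rfl] at h
  zero_pos n hn x hx y hy z hz := by
    obtain ⟨n, rfl⟩ := Nat.exists_eq_add_of_le' hn
    -- Composing with `xi ^ n` applied to `z` cancels the same twist in the formula for the second
    -- input.
    have hz' := (P.toTypedGradedAlgebra hk).xi_pow_mem hz n
    obtain ⟨x, rfl⟩ := P.exists_ofOp_eq hk hx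
    obtain ⟨y, rfl⟩ := P.exists_ofOp_eq hk hy
    obtain ⟨z', hz'⟩ := P.exists_ofOp_eq hk hz'
    have h := P.compFun_par hk (l := 2) (m := 1) (n := n + 2) (r := 2) (q := n + 3) (s := n + 3)
      rfl (by omega) (by omega) 0 1 1 0 (by simp) rfl rfl x y z'
    rw [TypedGradedAlgebra.compFun_two rfl, TypedGradedAlgebra.compFun_of_eq_zero rfl,
      TypedGradedAlgebra.compFun_of_eq_zero rfl, TypedGradedAlgebra.compFun_two rfl, hz',
      TypedGradedAlgebra.xi_pow_xi_pow, TypedGradedAlgebra.xi_pow_of_even _ (by grind)] at h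
    exact h
  pos_pos m n hm hn x hx y hy z hz := by
    obtain ⟨m, rfl⟩ := Nat.exists_eq_add_of_le' hm
    obtain ⟨n, rfl⟩ := Nat.exists_eq_add_of_le' hn
    obtain ⟨x, rfl⟩ := P.exists_ofOp_eq hk hx
    obtain ⟨y, rfl⟩ := P.exists_ofOp_eq hk hy
    obtain ⟨z, rfl⟩ := P.exists_ofOp_eq hk hz
    have h := P.compFun_par hk (l := 2) (m := m + 2) (n := n + 2) (r := m + 3) (q := n + 3)
      (s := m + n + 4) (by omega) (by omega) (by omega) 0 1 ⟨m + 2, by omega⟩ 0 (by simp)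
      (by simp; omega) rfl x y z
    rw [TypedGradedAlgebra.compFun_three, TypedGradedAlgebra.compFun_of_eq_zero rfl,
      TypedGradedAlgebra.compFun_of_eq_zero rfl, TypedGradedAlgebra.compFun_two rfl] at h
    rw [TypedGradedAlgebra.xi_pow_congr _ (a := n + 1 + 1) (b := n) (by grind)]
    exact h

theorem isPGPerm_toTypedGradedAlgebra : (P.toTypedGradedAlgebra hk).IsPGPerm := by
  refine (P.xiAxioms hk).isPGPerm hk fun i => ?_
  have := P.property.locallyFinite (i + 1)
  exact inferInstanceAs (Module.Finite k (LinearMap.range (DirectSum.lof k ℕ P.piece i)))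

end ATrivOperad

/-! ### Comparison isomorphisms -/

namespace PreOperad

variable {k : Type u} [Field k] {P Q : PreOperad.{v, u} k}

/-- A morphism with bijective components is an isomorphism. -/
noncomputable def isoOfBijective (f : Hom P Q) (hf : ∀ n, Function.Bijective (f.app n)) :
    P ≅ Q where
  hom := f
  inv :=
    { app := fun n => (LinearEquiv.ofBijective (f.app n) (hf n)).symm.toLinearMap
      map_act := fun {n} σ x => (hf n).1 <| by
        rw [f.map_act]
        simp only [LinearEquiv.coe_coe]
        exact ((LinearEquiv.ofBijective (f.app n) (hf n)).apply_symm_apply _).trans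
          (congrArg _ ((LinearEquiv.ofBijective (f.app n) (hf n)).apply_symm_apply _).symm)
      map_one := (LinearEquiv.symm_apply_eq _).2 f.map_one.symm
      map_comp := fun {m n r} h i x y => (hf r).1 <| by
        rw [f.map_comp]
        simp only [LinearEquiv.coe_coe]
        exact ((LinearEquiv.ofBijective (f.app r) (hf r)).apply_symm_apply _).trans
          (congrArg₂ (fun x y => Q.comp h i x y)
            ((LinearEquiv.ofBijective (f.app m) (hf m)).apply_symm_apply x).symm
            ((LinearEquiv.ofBijective (f.app n) (hf n)).apply_symm_apply y).symm) }
  hom_inv_id := Hom.ext <| funext fun n => LinearMap.ext fun x =>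
    (LinearEquiv.ofBijective (f.app n) (hf n)).symm_apply_apply x
  inv_hom_id := Hom.ext <| funext fun n => LinearMap.ext fun x =>
    (LinearEquiv.ofBijective (f.app n) (hf n)).apply_symm_apply x

end PreOperad

namespace TypedGradedAlgebra

variable {k : Type u} [Field k] {A B : TypedGradedAlgebra.{v, u} k}

/-- A bijective morphism that is surjective on all parts is an isomorphism. -/
noncomputable def isoOfBijective (f : Hom A B) (hf : Function.Bijective f.toAlgHom)
    (hpart : ∀ i t, ∀ y ∈ B.part i t, ∃ x ∈ A.part i t, f.toAlgHom x = y) : A ≅ B where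
  hom := f
  inv :=
    { toAlgHom := (AlgEquiv.ofBijective f.toAlgHom hf).symm.toAlgHom
      map_grading := fun i y hy => by
        refine B.grading_induction
          (p := fun y => (AlgEquiv.ofBijective f.toAlgHom hf).symm y ∈ A.grading i)
          (fun t y hy => ?_) (fun x y hx hy => ?_) hy
        · obtain ⟨x, hx, rfl⟩ := hpart i t y hy
          rw [show (AlgEquiv.ofBijective f.toAlgHom hf).symm (f.toAlgHom x) = x from
            (AlgEquiv.ofBijective f.toAlgHom hf).symm_apply_apply x]
          exact A.part_le i t hx
        · rw [map_add]
          exact add_mem hx hy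
      map_part := fun i t y hy => by
        obtain ⟨x, hx, rfl⟩ := hpart i t y hy
        exact ((AlgEquiv.ofBijective f.toAlgHom hf).symm_apply_apply x).symm ▸ hx }
  hom_inv_id := Hom.ext <| AlgHom.ext fun x =>
    (AlgEquiv.ofBijective f.toAlgHom hf).symm_apply_apply x
  inv_hom_id := Hom.ext <| AlgHom.ext fun x =>
    (AlgEquiv.ofBijective f.toAlgHom hf).apply_symm_apply x

end TypedGradedAlgebra

namespace ATrivOperad

variable {k : Type u} [Field k] (P : ATrivOperad.{v, u} k) (hk : ringChar k ≠ 2)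

/-- The comparison morphism `P ⟶ G(F(P))`. -/
noncomputable def toOperadOfAlgebra :
    PreOperad.Hom P.obj (P.toTypedGradedAlgebra hk).toPreOperad where
  app n := (P.ofOp hk n).codRestrict _ (P.ofOp_mem hk n)
  map_act σ x := Subtype.ext (P.ofOp_act hk σ x)
  map_one := Subtype.ext (P.ofOp_one hk)
  map_comp h i x y := Subtype.ext (P.ofOp_comp hk h i x y)

theorem toOperadOfAlgebra_bijective (n : ℕ) :
    Function.Bijective ((P.toOperadOfAlgebra hk).app n) := by
  refine ⟨fun x y hxy => P.ofOp_injective hk n (congrArg Subtype.val hxy), ?_⟩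
  rintro ⟨y, hy⟩
  -- In arity 0 both sides are zero: injectivity above rests on `P` being reduced, surjectivity on
  -- `arity 0` being `⊥`.
  obtain _ | n := n
  · exact ⟨0, Subtype.ext ((map_zero _).trans
      (TypedGradedAlgebra.eq_zero_of_mem_arity_zero hy).symm)⟩
  · obtain ⟨x, hx⟩ := P.exists_ofOp_eq hk hy
    exact ⟨x, Subtype.ext hx⟩

end ATrivOperad

namespace PGPermAlgebra

variable {k : Type u} [Field k] (hk : ringChar k ≠ 2) (A : PGPermAlgebra.{v, u} k)

/-- The operad `G(A)`. -/
noncomputable abbrev toOperad : ATrivOperad.{v, u} k :=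
  ⟨A.obj.toPreOperad, A.property.isATrivOperad hk⟩

/-- The linear map `F(G(A)) → A` given by the inclusions of the graded pieces. -/
noncomputable def counitLinear : (A.toOperad hk).total →ₗ[k] A.obj.carrier :=
  DirectSum.toModule k ℕ _ fun i => (A.obj.grading i).subtype

theorem counitLinear_lof (i : ℕ) (x : A.obj.grading i) :
    A.counitLinear hk (DirectSum.lof k ℕ (A.toOperad hk).piece i x) = x :=
  DirectSum.toModule_lof (M := (A.toOperad hk).piece) k i x

theorem counitLinear_bijective : Function.Bijective (A.counitLinear hk) :=
  DirectSum.Decomposition.isInternal A.obj.grading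

theorem counitLinear_mul (x y : (A.toOperad hk).total) :
    A.counitLinear hk (x * y) = A.counitLinear hk x * A.counitLinear hk y := by
  induction x using DirectSum.induction_on with
  | zero => simp
  | add x x' hx hx' => simp only [add_mul, map_add, hx, hx']
  | of i x =>
    induction y using DirectSum.induction_on with
    | zero => simp
    | add y y' hy hy' => simp only [mul_add, map_add, hy, hy']
    | of j y =>
      rw [DirectSum.of_mul_of]
      simp only [← DirectSum.lof_eq_of k]
      refine (A.counitLinear_lof hk (i + j) _).trans (Eq.trans ?_
        (congrArg₂ (· * ·) (A.counitLinear_lof hk i x).symm (A.counitLinear_lof hk j y).symm))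
      exact TypedGradedAlgebra.compFun_of_eq_zero (A := A.obj) (m := i + 1) (n := j + 1) (i := 0)
        rfl x.1 y.1

/-- In positive degree one transposition already acts as `xi`, so invariance is the eigenvalue
equation of the even part. Degree 0 has no transposition, and there the even part is everything by
convention. -/
theorem mem_trivPart_iff {i : ℕ} (x : A.obj.grading i) :
    (x : (A.toOperad hk).piece i) ∈ (A.toOperad hk).obj.trivPart (i + 1) ↔
      (x : A.obj.carrier) ∈ A.obj.part i 0 := by
  refine PreOperad.mem_trivPart.trans ⟨?_, ?_⟩
  · intro h
    obtain _ | i := i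
    · rw [← A.obj.grading_zero]
      exact x.2
    · refine A.obj.mem_part_of_xi hk 0 x.2 ?_
      have hτ : Equiv.Perm.sign (Equiv.swap (0 : Fin (i + 1 + 1)) 1) = (-1) ^ 1 := by
        rw [Equiv.Perm.sign_swap (by simp), pow_one]
      have h1 : A.obj.actFun (Equiv.swap (0 : Fin (i + 1 + 1)) 1) x.1 = x.1 :=
        congrArg Subtype.val (h (Equiv.swap 0 1))
      rw [TypedGradedAlgebra.actFun_eq_pow _ hτ, pow_one] at h1
      simpa using h1
  · intro h σ
    refine Subtype.ext ?_
    change A.obj.actFun σ x.1 = x.1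
    obtain ⟨e, he⟩ := TypedGradedAlgebra.exists_sign_eq_pow σ
    rw [TypedGradedAlgebra.actFun_eq_pow σ he, A.obj.xi_pow_part e 0 h]
    simp

theorem mem_signPart_iff {i : ℕ} (x : A.obj.grading (i + 1)) :
    (x : (A.toOperad hk).piece (i + 1)) ∈ (A.toOperad hk).obj.signPart (i + 2) ↔
      (x : A.obj.carrier) ∈ A.obj.part (i + 1) 1 := by
  refine PreOperad.mem_signPart.trans ⟨?_, ?_⟩
  · intro h
    refine A.obj.mem_part_of_xi hk 1 x.2 ?_
    have hτ : Equiv.Perm.sign (Equiv.swap (0 : Fin (i + 2)) 1) = (-1) ^ 1 := by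
      rw [Equiv.Perm.sign_swap (by simp), pow_one]
    have h1 : A.obj.actFun (Equiv.swap (0 : Fin (i + 2)) 1) x.1 =
        ((Equiv.Perm.sign (Equiv.swap (0 : Fin (i + 2)) 1) : ℤ) : k) • x.1 :=
      congrArg Subtype.val (h (Equiv.swap 0 1))
    rw [TypedGradedAlgebra.actFun_eq_pow _ hτ, pow_one, hτ] at h1
    simpa using h1
  · intro h σ
    refine Subtype.ext ?_
    change A.obj.actFun σ x.1 = ((Equiv.Perm.sign σ : ℤ) : k) • x.1
    obtain ⟨e, he⟩ := TypedGradedAlgebra.exists_sign_eq_pow σ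
    rw [TypedGradedAlgebra.actFun_eq_pow σ he, A.obj.xi_pow_part e 1 h, he, Int.cast_smul_eq_zsmul]
    simp

/-- The comparison morphism `F(G(A)) ⟶ A`. -/
noncomputable def counitHom :
    TypedGradedAlgebra.Hom ((A.toOperad hk).toTypedGradedAlgebra hk) A.obj where
  toAlgHom := AlgHom.ofLinearMap (A.counitLinear hk) (A.counitLinear_lof hk 0 ⟨1, _⟩)
    (A.counitLinear_mul hk)
  map_grading := by
    rintro i _ ⟨x, rfl⟩
    exact (A.counitLinear_lof hk i x).symm ▸ x.2
  map_part i t x hx := by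
    change x ∈ (A.toOperad hk).part i t at hx
    change A.counitLinear hk x ∈ _
    obtain rfl | rfl : t = 0 ∨ t = 1 := by omega
    · obtain ⟨x, hx, rfl⟩ := hx
      rw [A.counitLinear_lof hk i x]
      exact (A.mem_trivPart_iff hk x).1 hx
    · obtain _ | i := i
      · have h : x = 0 := hx
        subst h
        exact (congrArg (· ∈ A.obj.part 0 1) (map_zero (A.counitLinear hk))).mpr (zero_mem _)
      · obtain ⟨x, hx, rfl⟩ := hx
        rw [A.counitLinear_lof hk (i + 1) x]
        exact (A.mem_signPart_iff hk x).1 hx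

theorem counitHom_part (i : ℕ) (t : Fin 2) {y : A.obj.carrier} (hy : y ∈ A.obj.part i t) :
    ∃ x ∈ (A.toOperad hk).part i t, A.counitLinear hk x = y := by
  have hy' := A.obj.part_le i t hy
  refine ⟨DirectSum.lof k ℕ (A.toOperad hk).piece i ⟨y, hy'⟩, ?_, A.counitLinear_lof hk i ⟨y, hy'⟩⟩
  obtain rfl | rfl : t = 0 ∨ t = 1 := by omega
  · exact ⟨_, (A.mem_trivPart_iff hk ⟨y, hy'⟩).2 hy, rfl⟩
  · obtain _ | i := i
    · rw [A.obj.part_zero, Submodule.mem_bot] at hy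
      subst hy
      exact (congrArg (· ∈ (A.toOperad hk).part 0 1)
        (map_zero (DirectSum.lof k ℕ (A.toOperad hk).piece 0))).mpr (zero_mem _)
    · exact ⟨_, (A.mem_signPart_iff hk ⟨y, hy'⟩).2 hy, rfl⟩

end PGPermAlgebra

/-! ### The equivalence of categories -/

section Equivalence

variable {k : Type u} [Field k] (hk : ringChar k ≠ 2)

/-- The functor `G` from pseudo-graded-Perm algebras to `𝔸`-trivial operads. -/
noncomputable abbrev functorG
    (hG : ∀ A : PGPermAlgebra.{v, u} k, isATrivOperad.{v, u} k ((preG k).obj A)) :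
    PGPermAlgebra.{v, u} k ⥤ ATrivOperad.{v, u} k :=
  (isATrivOperad.{v, u} k).lift (preG k) hG

/-- The functor `F` from `𝔸`-trivial operads to pseudo-graded-Perm algebras. -/
noncomputable abbrev functorF
    (hF : ∀ P : ATrivOperad.{v, u} k, isPGPerm.{v, u} k ((preF k hk).obj P)) :
    ATrivOperad.{v, u} k ⥤ PGPermAlgebra.{v, u} k :=
  (isPGPerm.{v, u} k).lift (preF k hk) hF

/-- `F(G(A)) ≅ A`, naturally in `A`. -/
noncomputable def isoFG
    (hG : ∀ A : PGPermAlgebra.{v, u} k, isATrivOperad.{v, u} k ((preG k).obj A))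
    (hF : ∀ P : ATrivOperad.{v, u} k, isPGPerm.{v, u} k ((preF k hk).obj P)) :
    functorG hG ⋙ functorF hk hF ≅ 𝟭 (PGPermAlgebra.{v, u} k) :=
  NatIso.ofComponents
    (fun A => (isPGPerm.{v, u} k).isoMk (TypedGradedAlgebra.isoOfBijective (A.counitHom hk)
      (A.counitLinear_bijective hk) fun i t _ hy => A.counitHom_part hk i t hy))
    (fun {A B} f => by
      refine ObjectProperty.hom_ext _ (TypedGradedAlgebra.Hom.ext
        (AlgHom.toLinearMap_injective ?_))
      refine DirectSum.linearMap_ext k fun i => LinearMap.ext fun x => ?_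
      change B.counitLinear hk (ATrivOperad.totalMap ((functorG hG).map f)
        (DirectSum.lof k ℕ (A.toOperad hk).piece i x)) =
          f.hom.toAlgHom (A.counitLinear hk (DirectSum.lof k ℕ (A.toOperad hk).piece i x))
      rw [A.counitLinear_lof hk i x]
      refine (congrArg (B.counitLinear hk)
        (ATrivOperad.totalMap_lof ((functorG hG).map f) i x)).trans ?_
      exact B.counitLinear_lof hk i _)

/-- `P ≅ G(F(P))`, naturally in `P`. -/
noncomputable def isoGF
    (hG : ∀ A : PGPermAlgebra.{v, u} k, isATrivOperad.{v, u} k ((preG k).obj A))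
    (hF : ∀ P : ATrivOperad.{v, u} k, isPGPerm.{v, u} k ((preF k hk).obj P)) :
    𝟭 (ATrivOperad.{v, u} k) ≅ functorF hk hF ⋙ functorG hG :=
  NatIso.ofComponents
    (fun P => (isATrivOperad.{v, u} k).isoMk (PreOperad.isoOfBijective (P.toOperadOfAlgebra hk)
      (P.toOperadOfAlgebra_bijective hk)))
    (fun {P Q} f => by
      refine ObjectProperty.hom_ext _ (PreOperad.Hom.ext (funext fun n => LinearMap.ext fun x =>
        Subtype.ext ?_))
      change Q.ofOp hk n (f.hom.app n x) = ATrivOperad.totalMap f (P.ofOp hk n x)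
      obtain _ | n := n
      · exact (map_zero (ATrivOperad.totalMap f)).symm
      · exact (ATrivOperad.totalMap_lof f n x).symm)

/-- The functors `G` and `F` as an equivalence of categories. -/
noncomputable def equivalenceGF
    (hG : ∀ A : PGPermAlgebra.{v, u} k, isATrivOperad.{v, u} k ((preG k).obj A))
    (hF : ∀ P : ATrivOperad.{v, u} k, isPGPerm.{v, u} k ((preF k hk).obj P)) :
    PGPermAlgebra.{v, u} k ≌ ATrivOperad.{v, u} k :=
  -- This constructor adjusts only the unit, so the functor and the inverse are definitionally the
  -- given ones.
  CategoryTheory.Equivalence.mk (functorG hG) (functorF hk hF) (isoFG hk hG hF).symm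
    (isoGF hk hG hF).symm

end Equivalence

/-! ### Finite generation -/

namespace TypedGradedAlgebra

variable {k : Type u} [Field k] {A : TypedGradedAlgebra.{v, u} k}

theorem finitelyGenerated_toPreOperad (h : Algebra.FiniteType k A.carrier) :
    A.toPreOperad.FinitelyGenerated := by
  classical
  obtain ⟨s, hs⟩ := h.out
  -- The operadic generators are the nonzero homogeneous components of the algebra generators,
  -- shifted from degree `n` to arity `n + 1`.
  refine ⟨⋃ a ∈ s, (fun n => (⟨n + 1, decompose A.grading a n⟩ : Σ n, A.arity n)) ''
    ((decompose A.grading a).support : Set ℕ), ?_, ?_⟩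
  · exact s.finite_toSet.biUnion fun a _ => (Finset.finite_toSet _).image _
  intro S hX hone _ hcomp
  let M : ℕ → Submodule k A.carrier := fun n => (S (n + 1)).map (A.arity (n + 1)).subtype
  have hM : ∀ {n : ℕ} {x : A.carrier} (hx : x ∈ A.grading n), x ∈ M n → ⟨x, hx⟩ ∈ S (n + 1) := by
    rintro n _ hx ⟨y, hy, rfl⟩
    exact hy
  have hmul : ∀ {i j : ℕ} {x y : A.carrier}, x ∈ M i → y ∈ M j → x * y ∈ M (i + j) := by
    rintro i j _ _ ⟨x, hx, rfl⟩ ⟨y, hy, rfl⟩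
    refine ⟨_, hcomp (by omega : i + 1 + (j + 1) = i + j + 1 + 1) 0 x hx y hy, ?_⟩
    exact compFun_of_eq_zero rfl _ _
  -- Stated for all components of an arbitrary element, since words in inhomogeneous generators are
  -- not homogeneous.
  have hall : ∀ a : A.carrier, ∀ n, (decompose A.grading a n : A.carrier) ∈ M n := by
    intro a
    have ha : a ∈ Algebra.adjoin k (s : Set A.carrier) := hs ▸ Algebra.mem_top
    have h1 : (1 : A.carrier) ∈ M 0 := ⟨_, hone, rfl⟩
    induction ha using Algebra.adjoin_induction with
    | mem a ha =>
      intro n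
      by_cases hn : decompose A.grading a n = 0
      · rw [hn]
        exact zero_mem _
      · exact ⟨_, hX ⟨n + 1, decompose A.grading a n⟩ (Set.mem_biUnion ha
          ⟨n, by simpa using hn, rfl⟩), rfl⟩
    | algebraMap c =>
      intro n
      by_cases hn : n = 0
      · subst hn
        rw [decompose_of_mem_same _ (SetLike.algebraMap_mem_graded A.grading c),
          Algebra.algebraMap_eq_smul_one]
        exact Submodule.smul_mem _ c h1
      · rw [decompose_of_mem_ne _ (SetLike.algebraMap_mem_graded A.grading c) (Ne.symm hn)]
        exact zero_mem _
    | add a b _ _ ha hb =>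
      intro n
      rw [decompose_add, DirectSum.add_apply, Submodule.coe_add]
      exact add_mem (ha n) (hb n)
    | mul a b _ _ ha hb =>
      intro n
      rw [decompose_mul, DirectSum.coe_mul_apply]
      refine Submodule.sum_mem _ fun ij hij => ?_
      rw [← (Finset.mem_filter.1 hij).2]
      exact hmul (ha _) (hb _)
  intro n
  refine eq_top_iff.2 fun x _ => ?_
  obtain _ | n := n
  · have hx : x = 0 := Subtype.ext x.2
    rw [hx]
    exact zero_mem _
  · have h2 := hall x.1 n
    rw [decompose_of_mem_same A.grading (show x.1 ∈ A.grading n from x.2)] at h2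
    exact hM x.2 h2

/-- The algebra must reproduce the action as well, hence the generators `xi '' Y`. Since `xi` need
not pass through products of total degree at most 1, `A_0` and `A_1` are put in outright; this costs
finitely many generators by local finiteness. -/
theorem IsPGPerm.finiteType (hk : ringChar k ≠ 2) (hA : A.IsPGPerm)
    (hfg : A.toPreOperad.FinitelyGenerated) : Algebra.FiniteType k A.carrier := by
  have h := hA.xiAxioms hk
  obtain ⟨X, hX, hgen⟩ := hfg
  obtain ⟨g₀, hg₀, hspan₀⟩ := Submodule.fg_def.1 (Module.Finite.iff_fg.1 (hA.locallyFinite 0))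
  obtain ⟨g₁, hg₁, hspan₁⟩ := Submodule.fg_def.1 (Module.Finite.iff_fg.1 (hA.locallyFinite 1))
  let Y : Set A.carrier := (fun x : Σ n, A.arity n => (x.2 : A.carrier)) '' X
  have hY : Y.Finite := hX.image _
  let B : Subalgebra k A.carrier := Algebra.adjoin k (Y ∪ A.xi '' Y ∪ (g₀ ∪ g₁))
  have hYB : ∀ x ∈ Y, x ∈ B := fun x hx => Algebra.subset_adjoin (.inl (.inl hx))
  have hxiB : ∀ x ∈ Y, A.xi x ∈ B := fun x hx =>
    Algebra.subset_adjoin (.inl (.inr ⟨x, hx, rfl⟩))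
  have h₀ : A.grading 0 ≤ B.toSubmodule := by
    rw [← hspan₀, Submodule.span_le]
    exact fun x hx => Algebra.subset_adjoin (.inr (.inl hx))
  have h₁ : A.grading 1 ≤ B.toSubmodule := by
    rw [← hspan₁, Submodule.span_le]
    exact fun x hx => Algebra.subset_adjoin (.inr (.inr hx))
  have hsmall : ∀ {n : ℕ} {x : A.carrier}, n ≤ 1 → x ∈ A.grading n → x ∈ B := by
    intro n x hn hx
    obtain rfl | rfl : n = 0 ∨ n = 1 := by omega
    · exact h₀ hx
    · exact h₁ hx
  -- `B` is not known to be stable under `xi`, so the suboperad is cut out by the elements that stay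
  -- in `B` together with their image under `xi`.
  let C : Submodule k A.carrier := B.toSubmodule ⊓ B.toSubmodule.comap A.xi
  have hC : ∀ {x : A.carrier}, x ∈ C → ∀ e : ℕ, (A.xi ^ e) x ∈ B := by
    intro x hx e
    rcases Nat.even_or_odd e with he | he
    · rw [A.xi_pow_of_even he]
      exact hx.1
    · rw [A.xi_pow_of_odd he]
      exact hx.2
  have hact : ∀ {n : ℕ} (σ : Equiv.Perm (Fin n)), ∀ x ∈ C, A.actFun σ x ∈ C := by
    intro n σ x hx
    obtain ⟨e, he⟩ := exists_sign_eq_pow σ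
    rw [actFun_eq_pow σ he]
    refine ⟨hC hx e, ?_⟩
    change A.xi ((A.xi ^ e) x) ∈ B
    rw [A.xi_eq_pow, xi_pow_xi_pow]
    exact hC hx _
  have hcomp : ∀ {m n r : ℕ} (_ : m + n = r + 1) (i : Fin m), ∀ x ∈ A.arity m, ∀ y ∈ A.arity n,
      x ∈ C → y ∈ C → A.compFun m n i x y ∈ C := by
    intro m n r hr i x hx y hy hxC hyC
    obtain _ | m := m
    · exact i.elim0
    obtain _ | n := n
    · rw [eq_zero_of_mem_arity_zero hy, compFun_zero_right]
      exact zero_mem _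
    obtain rfl : r = m + n + 1 := by omega
    have hmem : A.compFun (m + 1) (n + 1) i x y ∈ A.grading (m + n) := A.compFun_mem hr i hx hy
    simp only [arity] at hx hy
    -- Above total degree 1, either `x` has degree at least 2 or `y` has positive degree, so `xi` of
    -- the product can be moved onto one factor.
    by_cases hmn : m + n ≤ 1
    · exact ⟨hsmall hmn hmem, hsmall hmn (A.xi_mem hmem)⟩
    by_cases hm : 2 ≤ m
    · obtain ⟨m, rfl⟩ := Nat.exists_eq_add_of_le' hm
      rw [compFun_three]
      refine ⟨B.mul_mem (hC hxC _) hyC.1, ?_⟩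
      change A.xi _ ∈ B
      rw [h.xi_mul_left _ n hm _ (A.xi_pow_mem hx _) y hy]
      refine mul_mem ?_ hyC.1
      rw [A.xi_eq_pow, xi_pow_xi_pow]
      exact hC hxC _
    by_cases hi : (i : ℕ) = 0
    · rw [compFun_of_eq_zero hi]
      refine ⟨B.mul_mem hxC.1 hyC.1, ?_⟩
      change A.xi _ ∈ B
      rw [h.xi_mul_right m n (by omega) x hx y hy]
      exact mul_mem hxC.1 hyC.2
    obtain rfl : m = 1 := by omega
    obtain ⟨n, rfl⟩ := Nat.exists_eq_add_of_le' (by omega : 1 ≤ n)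
    rw [compFun_two (by omega)]
    refine ⟨B.mul_mem hxC.2 (hC hyC _), ?_⟩
    change A.xi _ ∈ B
    rw [h.xi_mul_right 1 _ (by omega) _ (A.xi_mem hx) _ (A.xi_pow_mem hy _),
      A.xi_eq_pow ((A.xi ^ n) y), xi_pow_xi_pow]
    exact mul_mem hxC.2 (hC hyC _)
  have htop := hgen (fun n => C.comap (A.arity n).subtype)
    (fun x hx => ⟨hYB _ ⟨x, hx, rfl⟩, hxiB _ ⟨x, hx, rfl⟩⟩)
    ⟨B.one_mem, h₀ (A.xi_mem (SetLike.one_mem_graded A.grading))⟩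
    (fun σ x hx => hact σ x.1 hx)
    (fun hr i x hx y hy => hcomp hr i x.1 x.2 y.1 y.2 hx hy)
  have hB : B = ⊤ := by
    refine eq_top_iff.2 fun a _ => ?_
    induction a using DirectSum.Decomposition.inductionOn A.grading with
    | zero => exact zero_mem _
    | add a b ha hb => exact add_mem (ha trivial) (hb trivial)
    | @homogeneous n a =>
      have ha : ∀ y : A.arity (n + 1), y.1 ∈ C := fun y =>
        (htop (n + 1)).ge (Submodule.mem_top (x := y))
      exact (ha a).1
  exact ⟨Subalgebra.fg_def.2 ⟨_, ((hY.union (hY.image _)).union (hg₀.union hg₁)), hB⟩⟩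

end TypedGradedAlgebra

theorem theorem5p6 (k : Type u) [Field k] (hk : ringChar k ≠ 2) :
    ∃ (hG : ∀ A : PGPermAlgebra.{v, u} k, isATrivOperad.{v, u} k ((preG k).obj A))
      (hF : ∀ P : ATrivOperad.{v, u} k, isPGPerm.{v, u} k ((preF k hk).obj P)),
      (∃ e : PGPermAlgebra.{v, u} k ≌ ATrivOperad.{v, u} k,
        e.functor = (isATrivOperad.{v, u} k).lift (preG k) hG ∧
        e.inverse = (isPGPerm.{v, u} k).lift (preF k hk) hF) ∧
      ∀ A : PGPermAlgebra.{v, u} k,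
        Algebra.FiniteType k A.obj.carrier ↔
          (((isATrivOperad.{v, u} k).lift (preG k) hG).obj A).obj.FinitelyGenerated := by
  have hG : ∀ A : PGPermAlgebra.{v, u} k, isATrivOperad.{v, u} k ((preG k).obj A) :=
    fun A => A.property.isATrivOperad hk
  have hF : ∀ P : ATrivOperad.{v, u} k, isPGPerm.{v, u} k ((preF k hk).obj P) :=
    fun P => P.isPGPerm_toTypedGradedAlgebra hk
  exact ⟨hG, hF, ⟨equivalenceGF hk hG hF, rfl, rfl⟩, fun A =>
    ⟨fun h => TypedGradedAlgebra.finitelyGenerated_toPreOperad h,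
      fun h => A.property.finiteType hk h⟩⟩
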